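/- **Setting.** Let $\mathcal X$ be a measurable space, $\mathcal Z\subset\mathbb R^{q}$ and $\mathcal W\subset\mathbb R^{d}$ bounded sets, $\mathcal D$ a probability measure on $\mathcal X\times\mathcal Z$ (the law of $(X,Z)$), $\lambda\ge 0$, and $\mathcal H$ a linear space of measurable functions $\mathcal W\to\mathbb R$. Let $\Phi(x,z;f)$ and $\Psi(x,z;f)$ be real functionals of $f\in\mathcal H$ such that * $f\mapsto\Phi(x,z;f)-\Phi(x,z;0)$ is linear on $\mathcal H$; * $\Psi(x,z;\cdot)$ is convex and nonnegative on $\mathcal H$, and $\Psi(x,z;0)=0$; * for $f\in\mathcal H$ they have variations $\frac{\delta\Phi(x,z;f)}{\delta f}$, $\frac{\delta\Psi(x,z;f)}{\delta f}$, which are finite signed measures on $\mathcal W$, each given as a difference of two finite positive measures depending measurably on $(x,z)$, with $\frac{d}{d\varepsilon}\Phi(x,z;f+\varepsilon h)\big|_{\varepsilon=0}=\int h\,d\frac{\delta\Phi(x,z;f)}{\delta f}$ for all $h\in\mathcal H$ (every $h\in\mathcal H$ being integrable), and likewise for $\Psi$; $\int h\,d\frac{\delta\Psi(x,z;f)}{\delta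 f}$ is linear in $f\in\mathcal H$; * writing $|\cdot|$ for the sum of the two positive measures, for all $f,h\in\mathcal H$ the functions $\int |h|\,d\big|\frac{\delta\Phi(X,Z;f)}{\delta f}\big|$, $\big|\frac{\delta\Phi(X,Z;f)}{\delta f}\big|(\mathcal W)$ and $\Phi(X,Z;0)$ are square-integrable, and $\int |h|\,d\big|\frac{\delta\Psi(X,Z;f)}{\delta f}\big|$ and $\big|\frac{\delta\Psi(X,Z;f)}{\delta f}\big|(\mathcal W)$ are integrable, under $\mathcal D$. For $f\in\mathcal H$ and measurable $g:\mathcal Z\to\mathbb R$ with $\mathbb E\,g(Z)^2<\infty$ put $$\mathcal L(f,g)=\mathbb E_{\mathcal D}\Big[g(Z)\,\Phi(X,Z;f)-\tfrac12 g(Z)^2+\lambda\Psi(X,Z;f)\Big].$$ A saddle point of $\mathcal L$ is a pair $(f,g)$ in these classes with $\mathcal L(f,g')\le\mathcal L(f,g)\le\mathcal L(f',g)$ for all $f',g'$ in these classes. **Networks.** Let $b,\sigma:\mathbb R\to\mathbb R$, with $b$ odd, $b(\mathbb R)=(-B_0,B_0)$, and $\sigma$ not a polynomial. Put $\phi(w;\theta)=b(\beta)\,\sigma(\tilde\theta^\top(w,1))$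 for $w\in\mathcal W$, $\theta=(\beta,\tilde\theta)\in\mathbb R\times\mathbb R^{d+1}$, and $\psi(z;\omega)=b(\beta)\,\sigma(\tilde\omega^\top(z,1))$ for $z\in\mathcal Z$, $\omega=(\beta,\tilde\omega)\in\mathbb R\times\mathbb R^{q+1}$. Assume that $\phi$ and $\psi$ are twice differentiable in the parameter, and that for constants $B_0,B_1,B_2>0$, uniformly over inputs and parameters, $|\phi|,|\psi|\le B_0$, their parameter gradients have Euclidean norm at most $B_1$ and their parameter Hessians have Frobenius norm at most $B_2$. For $\alpha>0$ and probability measures $\mu,\nu$ on the two parameter spaces let $$f_\alpha(\cdot;\mu)=\alpha\int\phi(\cdot;\theta)\,\mu(d\theta),\qquad g_\alpha(\cdot;\nu)=\alpha\int\psi(\cdot;\omega)\,\nu(d\omega),$$ and assume $f_1(\cdot;\mu)\in\mathcal H$ for every $\mu$ with finite second moment. Call $(\mu,\nu)$ *stationary* (for the scale $\alpha$) if $v^f(\theta;\mu,\nu)=0$ and $v^g(\omega;\mu,\nu)=0$ for all $\theta,\omega$, where, with $f=f_\alpha(\cdot;\mu)$ and $g=g_\alpha(\cdot;\nu)$, $$v^f(\theta;\mu,\nu)=\alpha\,\mathbb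 E_{\mathcal D}\Big[-g(Z)\int\nabla_\theta\phi(w;\theta)\,\tfrac{\delta\Phi(X,Z;f)}{\delta f}(dw)-\lambda\int\nabla_\theta\phi(w;\theta)\,\tfrac{\delta\Psi(X,Z;f)}{\delta f}(dw)\Big],$$ $$v^g(\omega;\mu,\nu)=\alpha\,\mathbb E_{\mathcal D}\big[(\Phi(X,Z;f)-g(Z))\,\nabla_\omega\psi(Z;\omega)\big].$$ Let $\mu_0,\nu_0$ be the standard Gaussian measures on the two parameter spaces, $W_2$ the Wasserstein-2 distance, and $\chi^2(\mu\|\mu_0)=\int(\frac{d\mu}{d\mu_0}-1)^2d\mu_0$ (equal to $+\infty$ if $\mu\not\ll\mu_0$). **Statement.** (i) Let $\alpha>0$. If $(\mu^*,\nu^*)$ is stationary and $f_\alpha(\cdot;\mu^*)\in\mathcal H$ (automatic if $\mu^*$ has finite second moment), then $(f_\alpha(\cdot;\mu^*),g_\alpha(\cdot;\nu^*))$ is a saddle point of $\mathcal L$. (ii) Suppose that $\mathcal L$ has a saddle point $(f^*,g^*)$ of the form $f^*=\int\phi(\cdot;\theta)\,\mu^\dagger(d\theta)$, $g^*=\int\psi(\cdot;\omega)\,\nu^\dagger(d\omega)$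 with probability measures $\mu^\dagger,\nu^\dagger$ that have finite second moments. Then for every $\alpha\ge1$ there are a stationary pair $(\mu^*,\nu^*)$ and a constant $\bar D>0$ with $$W_2(\mu_0,\mu^*)\le\alpha^{-1}\bar D,\qquad W_2(\nu_0,\nu^*)\le\alpha^{-1}\bar D .$$ If moreover $\chi^2(\mu^\dagger\|\mu_0)<\infty$ and $\chi^2(\nu^\dagger\|\nu_0)<\infty$, then $\bar D$ can be chosen independently of $\alpha$: there is $\bar D>0$ such that for every $\alpha\ge1$ there is a stationary pair $(\mu^*,\nu^*)$ satisfying both bounds. -/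

import Mathlib

open MeasureTheory ProbabilityTheory
open scoped ENNReal

namespace MeanFieldMinimax

noncomputable section

/-- Parameters `θ = (β, θ̃)` of a neuron with `d`-dimensional input: coordinate `0` is the output
weight `β`, coordinates `1, …, d` are the hidden weights, coordinate `d + 1` is the bias. -/
abbrev Param (d : ℕ) : Type := EuclideanSpace ℝ (Fin (d + 2))

/-- The neuron `b(β) * σ(θ̃ᵀ (w, 1))`. -/
def neuron (b σ : ℝ → ℝ) {d : ℕ} (w : EuclideanSpace ℝ (Fin d)) (θ : Param d) : ℝ :=
  b (θ 0) * σ ((∑ i : Fin d, θ i.castSucc.succ * w i) + θ (Fin.last (d + 1)))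

/-- The mean-field network `α ∫ neuron(·; θ) μ(dθ)` as a function on the input domain `S`. -/
def net (b σ : ℝ → ℝ) {d : ℕ} (S : Set (EuclideanSpace ℝ (Fin d))) (α : ℝ)
    (μ : Measure (Param d)) : S → ℝ :=
  fun w => α * ∫ θ, neuron b σ (w : EuclideanSpace ℝ (Fin d)) θ ∂μ

/-- Regularity of the neurons over the input domain `S`: twice differentiable in the parameter,
with the value, the Euclidean norm of the gradient and the Frobenius norm of the Hessian bounded
by `B₀`, `B₁`, `B₂`. -/
structure NeuronRegular (b σ : ℝ → ℝ) (B₀ B₁ B₂ : ℝ) {d : ℕ}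
    (S : Set (EuclideanSpace ℝ (Fin d))) : Prop where
  bound : ∀ w ∈ S, ∀ θ : Param d, |neuron b σ w θ| ≤ B₀
  differentiable : ∀ w ∈ S, Differentiable ℝ (neuron b σ w)
  bound_gradient : ∀ w ∈ S, ∀ θ : Param d, ‖gradient (neuron b σ w) θ‖ ≤ B₁
  differentiable_gradient : ∀ w ∈ S, Differentiable ℝ (gradient (neuron b σ w))
  bound_hessian : ∀ w ∈ S, ∀ θ : Param d,
    Real.sqrt (∑ i : Fin (d + 2),
      ‖fderiv ℝ (gradient (neuron b σ w)) θ (EuclideanSpace.single i 1)‖ ^ 2) ≤ B₂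

/-- `μ` is a probability measure with finite second moment. -/
def IsP2 {d : ℕ} (μ : Measure (Param d)) : Prop :=
  IsProbabilityMeasure μ ∧ ∫⁻ θ, ‖θ‖ₑ ^ 2 ∂μ < ∞

/-- The Wasserstein-2 distance, as an infimum over all couplings. -/
def W2 {d : ℕ} (μ ν : Measure (Param d)) : ℝ≥0∞ :=
  (⨅ γ ∈ {γ : Measure (Param d × Param d) | γ.map Prod.fst = μ ∧ γ.map Prod.snd = ν},
    ∫⁻ p, edist p.1 p.2 ^ 2 ∂γ) ^ (1 / 2 : ℝ)

open Classical in
/-- The chi-square divergence `∫ (dμ/dν - 1)² dν`, infinite unless `μ ≪ ν`. -/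
def chiSq {d : ℕ} (μ ν : Measure (Param d)) : ℝ≥0∞ :=
  if μ ≪ ν then ∫⁻ θ, ENNReal.ofReal (((μ.rnDeriv ν θ).toReal - 1) ^ 2) ∂ν else ∞

/-- A measurable family `t ↦ pos t - neg t` of finite signed measures on `W`. -/
structure SignedKernel (T W : Type*) [MeasurableSpace T] [MeasurableSpace W] where
  pos : Kernel T W
  neg : Kernel T W
  sfinite_pos : IsSFiniteKernel pos
  sfinite_neg : IsSFiniteKernel neg
  finite_pos : ∀ t, IsFiniteMeasure (pos t)
  finite_neg : ∀ t, IsFiniteMeasure (neg t)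

namespace SignedKernel

variable {T W : Type*} [MeasurableSpace T] [MeasurableSpace W]

/-- The integral of `h` against the signed measure at `t`. -/
def pair {E : Type*} [NormedAddCommGroup E] [NormedSpace ℝ E] (κ : SignedKernel T W) (t : T)
    (h : W → E) : E :=
  ∫ w, h w ∂(κ.pos t) - ∫ w, h w ∂(κ.neg t)

/-- The integral of `|h|` against `pos t + neg t`. -/
def absPair (κ : SignedKernel T W) (t : T) (h : W → ℝ) : ℝ≥0∞ :=
  ∫⁻ w, ‖h w‖ₑ ∂(κ.pos t) + ∫⁻ w, ‖h w‖ₑ ∂(κ.neg t)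

/-- The signed measure `κ t` is the variation at `f` of the functional `G`, with test functions
in `F`: `d/dε G(f + ε h) |_{ε = 0} = ∫ h dκ_t` for all `h ∈ F`. -/
def IsVariation (κ : SignedKernel T W) (t : T) (F : Submodule ℝ (W → ℝ)) (G : (W → ℝ) → ℝ)
    (f : W → ℝ) : Prop :=
  ∀ h ∈ F, κ.absPair t h < ∞ ∧ HasDerivAt (fun ε : ℝ => G (f + ε • h)) (κ.pair t h) 0

end SignedKernel

/-- The data of the minimax problem: endogenous variables in `X`, exogenous variables in `Zs`,
primal functions on `Ws`. -/
structure Model (X : Type*) [MeasurableSpace X] {q d : ℕ}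
    (Zs : Set (EuclideanSpace ℝ (Fin q))) (Ws : Set (EuclideanSpace ℝ (Fin d))) where
  /-- the joint law of `(X, Z)` -/
  D : Measure (X × Zs)
  /-- the class of primal functions on which the functionals are defined -/
  F : Submodule ℝ (Ws → ℝ)
  /-- the moment functional `Φ(x, z; f)` -/
  Φ : X × Zs → (Ws → ℝ) → ℝ
  /-- the regularizer `Ψ(x, z; f)` -/
  Ψ : X × Zs → (Ws → ℝ) → ℝ
  /-- the variation `δΦ(x, z; f)/δf` -/
  varΦ : (Ws → ℝ) → SignedKernel (X × Zs) Ws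
  /-- the variation `δΨ(x, z; f)/δf` -/
  varΨ : (Ws → ℝ) → SignedKernel (X × Zs) Ws
  /-- the regularization parameter -/
  lam : ℝ

namespace Model

variable {X : Type*} [MeasurableSpace X] {q d : ℕ}
  {Zs : Set (EuclideanSpace ℝ (Fin q))} {Ws : Set (EuclideanSpace ℝ (Fin d))}

/-- The standing requirements on the data: `Φ` is affine in `f`; `Ψ` is convex, nonnegative,
vanishes at `0` and has a variation that is linear in `f`; the variations are as announced; and
the expectations that enter the objective and the velocity fields are absolutely convergent. -/
structure IsAdmissible (M : Model X Zs Ws) : Prop where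
  prob : IsProbabilityMeasure M.D
  lam_nonneg : 0 ≤ M.lam
  measurable : ∀ f ∈ M.F, Measurable f
  affine : ∀ t, ∀ f₁ ∈ M.F, ∀ f₂ ∈ M.F, ∀ a₁ a₂ : ℝ,
    M.Φ t (a₁ • f₁ + a₂ • f₂) - M.Φ t 0
      = a₁ * (M.Φ t f₁ - M.Φ t 0) + a₂ * (M.Φ t f₂ - M.Φ t 0)
  varΦ_spec : ∀ t, ∀ f ∈ M.F, (M.varΦ f).IsVariation t M.F (M.Φ t) f
  zero_memLp : MemLp (fun t => M.Φ t 0) 2 M.D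
  massΦ : ∀ f ∈ M.F, ∫⁻ t, (M.varΦ f).absPair t 1 ^ 2 ∂M.D < ∞
  integrableΦ : ∀ f ∈ M.F, ∀ h ∈ M.F, ∫⁻ t, (M.varΦ f).absPair t h ^ 2 ∂M.D < ∞
  convex : ∀ t, ConvexOn ℝ (M.F : Set (Ws → ℝ)) (M.Ψ t)
  Ψ_zero : ∀ t, M.Ψ t 0 = 0
  Ψ_nonneg : ∀ t, ∀ f ∈ M.F, 0 ≤ M.Ψ t f
  varΨ_spec : ∀ t, ∀ f ∈ M.F, (M.varΨ f).IsVariation t M.F (M.Ψ t) f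
  varΨ_linear : ∀ t, ∀ f₁ ∈ M.F, ∀ f₂ ∈ M.F, ∀ a₁ a₂ : ℝ, ∀ h ∈ M.F,
    (M.varΨ (a₁ • f₁ + a₂ • f₂)).pair t h
      = a₁ * (M.varΨ f₁).pair t h + a₂ * (M.varΨ f₂).pair t h
  massΨ : ∀ f ∈ M.F, ∫⁻ t, (M.varΨ f).absPair t 1 ∂M.D < ∞
  integrableΨ : ∀ f ∈ M.F, ∀ h ∈ M.F, ∫⁻ t, (M.varΨ f).absPair t h ∂M.D < ∞

/-- The class of dual functions: `g` measurable with `E g(Z)² < ∞`. -/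
def dualClass (M : Model X Zs Ws) : Set (Zs → ℝ) :=
  {g | Measurable g ∧ MemLp (fun t : X × Zs => g t.2) 2 M.D}

/-- The objective `L(f, g) = E [g(Z) Φ(X, Z; f) - g(Z)² / 2 + λ Ψ(X, Z; f)]`. -/
def objective (M : Model X Zs Ws) (f : Ws → ℝ) (g : Zs → ℝ) : ℝ :=
  ∫ t, (g t.2 * M.Φ t f - 1 / 2 * g t.2 ^ 2 + M.lam * M.Ψ t f) ∂M.D

/-- `(f, g)` is a saddle point of `min_f max_g L(f, g)`. -/
def IsSaddle (M : Model X Zs Ws) (f : Ws → ℝ) (g : Zs → ℝ) : Prop :=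
  f ∈ M.F ∧ g ∈ M.dualClass ∧
    IsSaddlePointOn (M.F : Set (Ws → ℝ)) M.dualClass M.objective f g

/-- The velocity field `v^f(θ; μ, ν)`. -/
def velF (M : Model X Zs Ws) (b σ : ℝ → ℝ) (α : ℝ) (μ : Measure (Param d))
    (ν : Measure (Param q)) (θ : Param d) : Param d :=
  α • ∫ t, (-(net b σ Zs α ν t.2) •
        (M.varΦ (net b σ Ws α μ)).pair t
          (fun w : Ws => gradient (neuron b σ (w : EuclideanSpace ℝ (Fin d))) θ)
      - M.lam • (M.varΨ (net b σ Ws α μ)).pair t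
          (fun w : Ws => gradient (neuron b σ (w : EuclideanSpace ℝ (Fin d))) θ)) ∂M.D

/-- The velocity field `v^g(ω; μ, ν)`. -/
def velG (M : Model X Zs Ws) (b σ : ℝ → ℝ) (α : ℝ) (μ : Measure (Param d))
    (ν : Measure (Param q)) (ω : Param q) : Param q :=
  α • ∫ t, (M.Φ t (net b σ Ws α μ) - net b σ Zs α ν t.2) •
      gradient (neuron b σ (t.2 : EuclideanSpace ℝ (Fin q))) ω ∂M.D

/-- `(μ, ν)` is a stationary point of the Wasserstein gradient flow: a pair of probability
measures at which both velocity fields vanish identically. -/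
def IsStationary (M : Model X Zs Ws) (b σ : ℝ → ℝ) (α : ℝ) (μ : Measure (Param d))
    (ν : Measure (Param q)) : Prop :=
  IsProbabilityMeasure μ ∧ IsProbabilityMeasure ν ∧
    (∀ θ, M.velF b σ α μ ν θ = 0) ∧ ∀ ω, M.velG b σ α μ ν ω = 0

end Model

end

end MeanFieldMinimax

namespace MeanFieldMinimax

open Set Filter Topology

/-! Along every line the objective is exactly quadratic: `Φ` is affine in `f`, and `Ψ` is a
quadratic form because its variation is linear and `Ψ(0) = 0`. It is convex in `f` and concave in
`g`, so for bounded `g` a pair is a saddle point iff the first-order conditions hold: the signed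
measure `posMeasure - negMeasure` on `Ws` annihilates the primal class, and the residual `Φ - g` is
orthogonal to all dual functions of `Z`.

Stationarity implies these conditions. The `β`-component of a neuron's gradient is `b'(β)` times a
ridge function, and finite signed measures on a bounded set that annihilate all ridge functions of
`σ` vanish (`ext_of_ridge`). For this `σ` need only be continuous, bounded and nonconstant:
differentiating a mollified ridge integral in the dilation parameter yields all moments. Conversely,
at a saddle point the conditions hold for single neurons, and differentiating in the parameter gives
vanishing velocities.

For (ii) the witnesses are the mixtures `(1 - α⁻¹) μ₀ + α⁻¹ μ†`. Since `b` is odd, the Gaussian part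
contributes the zero network, so at scale `α` the mixture represents the given saddle point for
every `α ≥ 1`. A second-moment bound makes the distance to `μ₀` finite uniformly in `α`, which
settles the first bound.

For the `α⁻¹` rate, the mixture has density `1 + α⁻¹ (r - 1)` with `r = dμ†/dμ₀`, which is at least
`1/2` once `α ≥ 2` and has chi-square divergence `α⁻² χ²`. The needed inequality `W₂² ≤ 16 (d + 2)
χ²` for densities at least `1/2` comes from a coordinatewise monotone rearrangement of Knothe type.
In one dimension its cost is controlled by the weighted `L²` norm of the difference of distribution
functions, hence by a Gaussian Hardy inequality. -/

/-! ### Gaussian Hardy inequality on the positive half-line. -/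

/-- A weighted Cauchy-Schwarz inequality for the Lebesgue integral. -/
lemma sq_lintegral_le {α : Type*} [MeasurableSpace α] (μ : Measure α) {k w : α → ℝ≥0∞}
    (hk : Measurable k) (hw : Measurable w) (hw0 : ∀ᵐ x ∂μ, w x ≠ 0 ∧ w x ≠ ∞) :
    (∫⁻ x, k x ∂μ) ^ 2 ≤ (∫⁻ x, k x ^ 2 / w x ∂μ) * ∫⁻ x, w x ∂μ := by
  have h := ENNReal.lintegral_mul_le_Lp_mul_Lq μ Real.HolderConjugate.two_two
    (f := fun x => k x / w x ^ (1 / 2 : ℝ)) (g := fun x => w x ^ (1 / 2 : ℝ))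
    (by fun_prop) (by fun_prop)
  have h1 : ∫⁻ x, ((fun x => k x / w x ^ (1 / 2 : ℝ)) * fun x => w x ^ (1 / 2 : ℝ)) x ∂μ
      = ∫⁻ x, k x ∂μ := by
    refine lintegral_congr_ae ?_
    filter_upwards [hw0] with x hx
    simp only [Pi.mul_apply]
    exact ENNReal.div_mul_cancel (by simp [hx.1, hx.2]) (by simp [hx.1, hx.2])
  have h2 : ∀ x, (k x / w x ^ (1 / 2 : ℝ)) ^ (2 : ℝ) = k x ^ 2 / w x := by
    intro x
    rw [ENNReal.div_rpow_of_nonneg _ _ (by norm_num), ← ENNReal.rpow_mul]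
    norm_num
  have h3 : ∀ x, (w x ^ (1 / 2 : ℝ)) ^ (2 : ℝ) = w x := by
    intro x
    rw [← ENNReal.rpow_mul]
    norm_num
  simp only [h1, h2, h3] at h
  calc (∫⁻ x, k x ∂μ) ^ 2
      ≤ ((∫⁻ x, k x ^ 2 / w x ∂μ) ^ (1 / 2 : ℝ) * (∫⁻ x, w x ∂μ) ^ (1 / 2 : ℝ)) ^ 2 := by gcongr
    _ = _ := by
      rw [mul_pow, ← ENNReal.rpow_natCast, ← ENNReal.rpow_natCast, ← ENNReal.rpow_mul,
        ← ENNReal.rpow_mul]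
      norm_num

lemma hasDerivAt_gaussianPDFReal (x : ℝ) :
    HasDerivAt (gaussianPDFReal 0 1) (-(x * gaussianPDFReal 0 1 x)) x := by
  unfold gaussianPDFReal
  have h : HasDerivAt (fun x : ℝ => -(x - 0) ^ 2 / (2 * ((1 : NNReal) : ℝ))) (-x) x := by
    have := (((hasDerivAt_id x).sub_const 0).pow 2).neg.div_const (2 * ((1 : NNReal) : ℝ))
    exact HasDerivAt.congr_deriv this (by simp; ring)
  refine ((h.exp).const_mul (√(2 * Real.pi * ((1 : NNReal) : ℝ)))⁻¹).congr_deriv ?_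
  ring

lemma tendsto_gaussianPDFReal_atTop : Tendsto (gaussianPDFReal 0 1) atTop (𝓝 0) := by
  unfold gaussianPDFReal
  have h : Tendsto (fun x : ℝ => -(x - 0) ^ 2 / (2 * ((1 : NNReal) : ℝ))) atTop atBot := by
    have : Tendsto (fun x : ℝ => x ^ 2 / 2) atTop atTop :=
      (tendsto_pow_atTop (two_ne_zero)).atTop_div_const (by norm_num)
    refine (tendsto_neg_atTop_atBot.comp this).congr fun x => ?_
    simp [neg_div]
  simpa using (Real.tendsto_exp_atBot.comp h).const_mul (√(2 * Real.pi * ((1 : NNReal) : ℝ)))⁻¹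

/-- The Gaussian density `p` satisfies `p' = -x p`, so the tail integral of `x` is `p(s)` itself.
This makes `x` the right weight in the Hardy inequality. -/
lemma lintegral_Ioi_id_gaussianReal {s : ℝ} (hs : 0 ≤ s) :
    ∫⁻ x in Ioi s, ENNReal.ofReal x ∂(gaussianReal 0 1) = gaussianPDF 0 1 s := by
  have hd : ∀ x ∈ Ici s, HasDerivAt (fun x => -gaussianPDFReal 0 1 x)
      (x * gaussianPDFReal 0 1 x) x := fun x _ => by
    have h := (hasDerivAt_gaussianPDFReal x).neg
    rw [neg_neg] at h
    exact h
  have hlim : Tendsto (fun x => -gaussianPDFReal 0 1 x) atTop (𝓝 0) := by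
    simpa using tendsto_gaussianPDFReal_atTop.neg
  have hnn : ∀ x ∈ Ioi s, 0 ≤ x * gaussianPDFReal 0 1 x := fun x hx =>
    mul_nonneg (hs.trans (le_of_lt hx)) (gaussianPDFReal_nonneg _ _ _)
  have hint := integrableOn_Ioi_deriv_of_nonneg' hd hnn hlim
  have hval := integral_Ioi_of_hasDerivAt_of_tendsto' hd hint hlim
  rw [gaussianReal_of_var_ne_zero _ one_ne_zero, restrict_withDensity measurableSet_Ioi,
    lintegral_withDensity_eq_lintegral_mul _ (measurable_gaussianPDF 0 1) (by fun_prop)]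
  calc _ = ∫⁻ x in Ioi s, ENNReal.ofReal (x * gaussianPDFReal 0 1 x) := by
        refine setLIntegral_congr_fun measurableSet_Ioi fun x hx => ?_
        simp only [Pi.mul_apply, gaussianPDF]
        rw [← ENNReal.ofReal_mul (gaussianPDFReal_nonneg _ _ _), mul_comm]
    _ = ENNReal.ofReal (∫ x in Ioi s, x * gaussianPDFReal 0 1 x) :=
        (ofReal_integral_eq_lintegral_ofReal hint
          ((ae_restrict_iff' measurableSet_Ioi).2 (ae_of_all _ hnn))).symm
    _ = _ := by rw [hval]; simp [gaussianPDF]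

/-- A Hardy inequality on the positive half-line for the Gaussian weight. -/
lemma hardy_Ioi {k : ℝ → ℝ≥0∞} (hk : Measurable k) :
    ∫⁻ s in Ioi (0 : ℝ), (∫⁻ x in Ioi s, k x ∂(gaussianReal 0 1)) ^ 2 / gaussianPDF 0 1 s
      ≤ ∫⁻ x in Ioi (0 : ℝ), k x ^ 2 ∂(gaussianReal 0 1) := by
  have hcs : ∀ s ∈ Ioi (0 : ℝ),
      (∫⁻ x in Ioi s, k x ∂(gaussianReal 0 1)) ^ 2 / gaussianPDF 0 1 s
        ≤ ∫⁻ x, (Ioi s).indicator (fun x => k x ^ 2 / ENNReal.ofReal x) x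
            ∂(gaussianReal 0 1) := by
    intro s hs
    rw [lintegral_indicator measurableSet_Ioi]
    refine ENNReal.div_le_of_le_mul ?_
    -- Cauchy-Schwarz with weight `x`: the second factor is exactly the density at `s`, which
    -- cancels the division.
    rw [← lintegral_Ioi_id_gaussianReal (le_of_lt hs)]
    refine sq_lintegral_le _ hk (by fun_prop) ?_
    refine (ae_restrict_iff' measurableSet_Ioi).2 (ae_of_all _ fun x hx => ?_)
    simp only [mem_Ioi] at hs hx
    simp [hs.trans hx]
  have hm : Measurable (Function.uncurry fun (s x : ℝ) =>
      (Ioi s).indicator (fun x => k x ^ 2 / ENNReal.ofReal x) x) := by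
    have : (Function.uncurry fun (s x : ℝ) =>
        (Ioi s).indicator (fun x => k x ^ 2 / ENNReal.ofReal x) x)
        = {p : ℝ × ℝ | p.1 < p.2}.indicator (fun p => k p.2 ^ 2 / ENNReal.ofReal p.2) := by
      ext ⟨s, x⟩
      simp [indicator]
    rw [this]
    exact Measurable.indicator (by fun_prop) (measurableSet_lt measurable_fst measurable_snd)
  calc _ ≤ ∫⁻ s in Ioi (0 : ℝ), ∫⁻ x,
          (Ioi s).indicator (fun x => k x ^ 2 / ENNReal.ofReal x) x ∂(gaussianReal 0 1) :=
        setLIntegral_mono' measurableSet_Ioi hcs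
    _ = ∫⁻ x, (∫⁻ s in Ioi (0 : ℝ), (Ioi s).indicator (fun x => k x ^ 2 / ENNReal.ofReal x) x)
          ∂(gaussianReal 0 1) := lintegral_lintegral_swap hm.aemeasurable
    _ ≤ ∫⁻ x, (Ioi (0 : ℝ)).indicator (fun x => k x ^ 2) x ∂(gaussianReal 0 1) := by
        refine lintegral_mono fun x => ?_
        have h1 : ∀ s, (Ioi s).indicator (fun x => k x ^ 2 / ENNReal.ofReal x) x
            = (Iio x).indicator (fun _ => k x ^ 2 / ENNReal.ofReal x) s := by
          intro s; simp [indicator]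
        simp only [h1]
        -- After the swap, the slice `0 < s < x` has length `x` and cancels the weight `1 / x`.
        rw [lintegral_indicator_const measurableSet_Iio, Measure.restrict_apply measurableSet_Iio,
          Iio_inter_Ioi, Real.volume_Ioo]
        by_cases hx : 0 < x
        · simp only [sub_zero, mem_Ioi, hx, indicator_of_mem]
          rw [ENNReal.div_mul_cancel (by simpa using hx) (by simp)]
        · simp [not_lt.1 hx]
    _ = _ := lintegral_indicator measurableSet_Ioi _

/-! ### Monotone rearrangement of measures on the line. -/

/-- The absolute difference of two extended nonnegative reals. -/
noncomputable def gap (a b : ℝ≥0∞) : ℝ≥0∞ := (a - b) + (b - a)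

section Rearrangement

variable (m n : Measure ℝ) [IsFiniteMeasure m] [NullSingletonClass m]
  [IsFiniteMeasure n] [NullSingletonClass n]

lemma continuous_measureReal_Iic : Continuous fun y => m.real (Iic y) := by
  have h : (fun y => m.real (Iic y)) = fun y => ∫ x, (Iic y).indicator (fun _ => (1 : ℝ)) x ∂m := by
    ext y
    rw [integral_indicator_const _ measurableSet_Iic]
    simp
  rw [h]
  refine continuous_iff_continuousAt.2 fun y => ?_
  refine continuousAt_of_dominated (bound := fun _ => 1)
    (Eventually.of_forall fun z =>
      (measurable_const.indicator measurableSet_Iic).aestronglyMeasurable)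
    (Eventually.of_forall fun z => ae_of_all _ fun x => ?_) (integrable_const _) ?_
  · by_cases hx : x ∈ Iic z <;> simp [hx]
  · have : ∀ᵐ x ∂m, x ≠ y := by
      rw [ae_iff]
      simp
    filter_upwards [this] with x hx
    rcases lt_or_gt_of_ne hx with hx | hx
    · refine continuousAt_const.congr (f := fun _ => (1 : ℝ)) ?_
      filter_upwards [lt_mem_nhds hx] with z hz
      simp [hz.le]
    · refine continuousAt_const.congr (f := fun _ => (0 : ℝ)) ?_
      filter_upwards [gt_mem_nhds hx] with z hz
      simp [hz]

lemma exists_measure_Iic_eq {v : ℝ≥0∞} (h0 : 0 < v) (h1 : v < m univ) : ∃ b, m (Iic b) = v := by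
  have hv : v ≠ ∞ := (h1.trans_le le_top).ne
  have hb := ((tendsto_measure_Iic_atTop m).eventually (lt_mem_nhds h1)).exists
  have hbot : Tendsto (fun y => m (Iic y)) atBot (𝓝 0) := by
    have := tendsto_measure_iInter_atBot (μ := m) (s := fun y : ℝ => Iic y)
      (fun _ => measurableSet_Iic.nullMeasurableSet) (fun a b hab => Iic_subset_Iic.2 hab)
      ⟨0, measure_ne_top _ _⟩
    have he : ⋂ y : ℝ, Iic y = ∅ := by
      rw [iInter_Iic_eq_empty_iff]
      simp
    rw [he, measure_empty] at this
    exact this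
  have ha := (hbot.eventually (gt_mem_nhds h0)).exists
  obtain ⟨a, ha⟩ := ha
  obtain ⟨b, hb⟩ := hb
  have := mem_range_of_exists_le_of_exists_ge (continuous_measureReal_Iic m) (c := v.toReal)
    ⟨a, (ENNReal.toReal_le_toReal (measure_ne_top _ _) hv).2 ha.le⟩
    ⟨b, (ENNReal.toReal_le_toReal hv (measure_ne_top _ _)).2 hb.le⟩
  obtain ⟨y, hy⟩ := this
  exact ⟨y, (ENNReal.toReal_eq_toReal_iff' (measure_ne_top _ _) hv).1 hy⟩

omit [IsFiniteMeasure m] [NullSingletonClass m] in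
lemma measure_Iic_add_Ioc {a b : ℝ} (hab : a ≤ b) : m (Iic b) = m (Iic a) + m (Ioc a b) := by
  rw [← measure_union (Iic_disjoint_Ioc le_rfl) measurableSet_Ioc, Iic_union_Ioc_eq_Iic hab]

lemma measure_Icc_eq_sub {a b : ℝ} (hab : a ≤ b) : m (Icc a b) = m (Iic b) - m (Iic a) := by
  rw [measure_Iic_add_Ioc m hab, ENNReal.add_sub_cancel_left (measure_ne_top _ _),
    measure_congr Ioc_ae_eq_Icc]

omit [NullSingletonClass m] in
lemma strictMono_measure_Iic [m.IsOpenPosMeasure] : StrictMono fun y => m (Iic y) := by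
  intro a b hab
  simp only [measure_Iic_add_Ioc m hab.le]
  exact ENNReal.lt_add_right (measure_ne_top _ _)
    (((Measure.measure_Ioo_pos m).2 hab).trans_le (measure_mono Ioo_subset_Ioc_self)).ne'

/-- The gap between the distribution functions of two measures. -/
noncomputable def cdfGap (s : ℝ) : ℝ≥0∞ := gap (n (Iic s)) (m (Iic s))

variable {m n} [m.IsOpenPosMeasure] [n.IsOpenPosMeasure] {S : ℝ → ℝ}
  (huniv : m univ = n univ) (hS : ∀ y, n (Iic (S y)) = m (Iic y))
include hS

omit [IsFiniteMeasure m] [NullSingletonClass m] [m.IsOpenPosMeasure] [NullSingletonClass n] in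
lemma rearrangement_le_iff {y s : ℝ} : S y ≤ s ↔ m (Iic y) ≤ n (Iic s) := by
  rw [← hS y, (strictMono_measure_Iic n).le_iff_le]

omit [IsFiniteMeasure m] [NullSingletonClass m] [m.IsOpenPosMeasure] [NullSingletonClass n] in
lemma le_rearrangement_iff {y s : ℝ} : s ≤ S y ↔ n (Iic s) ≤ m (Iic y) := by
  rw [← hS y, (strictMono_measure_Iic n).le_iff_le]

omit [IsFiniteMeasure m] [NullSingletonClass m] [m.IsOpenPosMeasure] [NullSingletonClass n] in
lemma measurable_rearrangement : Measurable S := by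
  refine Monotone.measurable fun a b hab => ?_
  rw [rearrangement_le_iff hS, hS]
  exact measure_mono (Iic_subset_Iic.2 hab)

include huniv

omit [m.IsOpenPosMeasure] [NullSingletonClass n] hS in
lemma exists_rearrangement_eq (s : ℝ) : ∃ b, m (Iic b) = n (Iic s) := by
  refine exists_measure_Iic_eq m ?_ ?_
  · exact bot_lt_iff_ne_bot.2 ((isOpen_Iio.measure_pos n nonempty_Iio).trans_le
      (measure_mono Iio_subset_Iic_self)).ne'
  · rw [huniv]
    have := strictMono_measure_Iic n (lt_add_one s)
    exact this.trans_le (measure_mono (subset_univ _))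

omit [NullSingletonClass n] in
lemma map_rearrangement : m.map S = n := by
  refine Measure.ext_of_Iic _ _ fun s => ?_
  rw [Measure.map_apply (measurable_rearrangement hS) measurableSet_Iic]
  obtain ⟨b, hb⟩ := exists_rearrangement_eq huniv s
  rw [← hb]
  congr 1
  ext y
  simp only [mem_preimage, mem_Iic]
  rw [rearrangement_le_iff hS, ← hb, (strictMono_measure_Iic m).le_iff_le]

omit [NullSingletonClass n] in
-- If `b` is the `m`-quantile at level `n (Iic s)`, then `S y ≤ s` iff `y ≤ b`. Hence the points
-- transported across `s` lie between `s` and `b`, an interval whose `m`-mass is the gap at `s`.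
lemma measure_mem_uIcc_rearrangement_le (s : ℝ) : m {y | s ∈ uIcc (S y) y} ≤ cdfGap m n s := by
  obtain ⟨b, hb⟩ := exists_rearrangement_eq huniv s
  have hsub : {y | s ∈ uIcc (S y) y} ⊆ Icc s b ∪ Icc b s := by
    intro y hy
    have h1 : S y ≤ s → y ≤ b := by
      rw [rearrangement_le_iff hS, ← hb, (strictMono_measure_Iic m).le_iff_le]; exact id
    have h2 : s ≤ S y → b ≤ y := by
      rw [le_rearrangement_iff hS, ← hb, (strictMono_measure_Iic m).le_iff_le]; exact id
    rcases mem_uIcc.1 hy with h | h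
    · exact Or.inl ⟨h.2, h1 h.1⟩
    · exact Or.inr ⟨h2 h.2, h.1⟩
  refine (measure_mono hsub).trans ((measure_union_le _ _).trans ?_)
  unfold cdfGap gap
  rw [← hb]
  have key : ∀ a b : ℝ, m (Icc a b) ≤ m (Iic b) - m (Iic a) := by
    intro a b
    rcases le_or_gt a b with h | h
    · exact (measure_Icc_eq_sub m h).le
    · simp [Icc_eq_empty_of_lt h]
  exact add_le_add (key _ _) (key _ _)

omit huniv [NullSingletonClass m] [m.IsOpenPosMeasure] [NullSingletonClass n]
  [n.IsOpenPosMeasure] in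
-- Split the interval at `s` and bound `γ` by `n` on the piece next to `S y` and by `m` on the piece
-- next to `y`. Since `n (Iic (S y)) = m (Iic y)`, the two masses add up to the gap at `s`.
lemma le_cdfGap {γ : Measure ℝ} (hm : γ ≤ m) (hn : γ ≤ n) {y s : ℝ} (hs : s ∈ uIcc (S y) y) :
    γ (uIoc (S y) y) ≤ cdfGap m n s := by
  have key : ∀ a b : ℝ, a ≤ s → s ≤ b → γ (Ioc a b) ≤ γ (Ioc a s) + γ (Ioc s b) := by
    intro a b h1 h2
    rw [← Ioc_union_Ioc_eq_Ioc h1 h2]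
    exact measure_union_le _ _
  unfold cdfGap gap
  rcases mem_uIcc.1 hs with h | h
  · rw [uIoc_of_le (h.1.trans h.2)]
    refine le_trans ?_ le_self_add
    rw [measure_Iic_add_Ioc n h.1, hS, measure_Iic_add_Ioc m h.2]
    refine (key _ _ h.1 h.2).trans ?_
    refine (add_le_add (hn _) (hm _)).trans ?_
    rw [add_assoc, ENNReal.add_sub_cancel_left (measure_ne_top _ _), add_comm]
  · rw [uIoc_of_ge (h.1.trans h.2)]
    refine le_trans ?_ le_add_self
    refine (key _ _ h.1 h.2).trans ?_
    refine (add_le_add (hm _) (hn _)).trans ?_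
    rw [measure_Iic_add_Ioc m h.1, ← hS, measure_Iic_add_Ioc n h.2]
    rw [add_assoc, ENNReal.add_sub_cancel_left (measure_ne_top _ _), add_comm]

end Rearrangement

/-! ### Gap calculus and the one-dimensional transport cost. -/

lemma measurable_cdfGap (m n : Measure ℝ) : Measurable (cdfGap m n) := by
  have : ∀ m : Measure ℝ, Measurable fun s => m (Iic s) := fun m =>
    Monotone.measurable fun a b hab => measure_mono (Iic_subset_Iic.2 hab)
  unfold cdfGap gap
  exact ((this n).sub (this m)).add ((this m).sub (this n))

lemma measurable_gap {α : Type*} [MeasurableSpace α] {f g : α → ℝ≥0∞} (hf : Measurable f)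
    (hg : Measurable g) : Measurable fun x => gap (f x) (g x) := by
  unfold gap
  exact (hf.sub hg).add (hg.sub hf)

lemma gap_comm (a b : ℝ≥0∞) : gap a b = gap b a := add_comm _ _

lemma gap_le_of_le_of_le {a b k : ℝ≥0∞} (h1 : a ≤ b + k) (h2 : b ≤ a + k) : gap a b ≤ k := by
  unfold gap
  rcases le_total a b with h | h
  · rw [tsub_eq_zero_of_le h, zero_add]
    exact tsub_le_iff_left.2 h2
  · rw [tsub_eq_zero_of_le h, add_zero]
    exact tsub_le_iff_left.2 h1

lemma le_add_gap (a b : ℝ≥0∞) : a ≤ b + gap a b :=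
  le_add_tsub.trans (add_le_add le_rfl le_self_add)

lemma le_add_gap' (a b : ℝ≥0∞) : a ≤ b + gap b a :=
  gap_comm a b ▸ le_add_gap a b

lemma gap_triangle (a b c : ℝ≥0∞) : gap a c ≤ gap a b + gap b c := by
  refine gap_le_of_le_of_le ?_ ?_
  · calc a ≤ b + gap a b := le_add_gap a b
      _ ≤ (c + gap b c) + gap a b := by gcongr; exact le_add_gap b c
      _ = _ := by ring
  · calc c ≤ b + gap b c := le_add_gap' c b
      _ ≤ (a + gap a b) + gap b c := by gcongr; exact le_add_gap' b a
      _ = _ := by ring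

lemma gap_lintegral_le {α : Type*} [MeasurableSpace α] (μ : Measure α) {f g : α → ℝ≥0∞}
    (hf : Measurable f) (hg : Measurable g) :
    gap (∫⁻ x, f x ∂μ) (∫⁻ x, g x ∂μ) ≤ ∫⁻ x, gap (f x) (g x) ∂μ := by
  refine gap_le_of_le_of_le ?_ ?_
  · rw [← lintegral_add_left hg]
    exact lintegral_mono fun x => le_add_gap _ _
  · rw [← lintegral_add_left hf]
    exact lintegral_mono fun x => le_add_gap' _ _

lemma add_sq_le_four_mul (a b : ℝ≥0∞) : (a + b) ^ 2 ≤ 4 * (a ^ 2 + b ^ 2) := by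
  have : ∀ a b : ℝ≥0∞, a ≤ b → (a + b) ^ 2 ≤ 4 * (a ^ 2 + b ^ 2) := by
    intro a b h
    calc (a + b) ^ 2 ≤ (b + b) ^ 2 := by gcongr
      _ = 4 * b ^ 2 := by ring
      _ ≤ _ := by gcongr; exact le_add_self
  rcases le_total a b with h | h
  · exact this a b h
  · rw [add_comm a, add_comm (a ^ 2)]
    exact this b a h

/-- A Hardy inequality on the negative half-line for the Gaussian weight. -/
lemma hardy_Iic {k : ℝ → ℝ≥0∞} (hk : Measurable k) :
    ∫⁻ s in Iic (0 : ℝ), (∫⁻ x in Iic s, k x ∂(gaussianReal 0 1)) ^ 2 / gaussianPDF 0 1 s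
      ≤ ∫⁻ x in Iic (0 : ℝ), k x ^ 2 ∂(gaussianReal 0 1) := by
  have hγ : MeasurePreserving (fun x : ℝ => -x) (gaussianReal 0 1) (gaussianReal 0 1) :=
    ⟨measurable_neg, by simpa using gaussianReal_map_neg (μ := 0) (v := 1)⟩
  have := nullSingletonClass_gaussianReal (μ := 0) (v := 1) one_ne_zero
  have hvol : MeasurePreserving (fun x : ℝ => -x) volume volume := Measure.measurePreserving_neg _
  have hpre : ∀ s : ℝ, (fun x : ℝ => -x) ⁻¹' Iic (-s) = Ici s := by
    intro s; ext x; simp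
  have hk' : ∀ (f : ℝ → ℝ≥0∞), Measurable f → ∀ s : ℝ,
      ∫⁻ x in Iic (-s), f x ∂(gaussianReal 0 1) = ∫⁻ x in Ioi s, f (-x) ∂(gaussianReal 0 1) := by
    intro f hf s
    rw [← hγ.setLIntegral_comp_preimage measurableSet_Iic hf, hpre,
      Measure.restrict_congr_set Ioi_ae_eq_Ici]
  have hpdf : ∀ s : ℝ, gaussianPDF 0 1 (-s) = gaussianPDF 0 1 s := by
    intro s; simp [gaussianPDF, gaussianPDFReal]
  have hmeas : Measurable fun s : ℝ =>
      (∫⁻ x in Iic s, k x ∂(gaussianReal 0 1)) ^ 2 / gaussianPDF 0 1 s := by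
    have h : Monotone fun s : ℝ => ∫⁻ x in Iic s, k x ∂(gaussianReal 0 1) := fun a b hab =>
      lintegral_mono_set (Iic_subset_Iic.2 hab)
    exact (h.measurable.pow_const 2).div (measurable_gaussianPDF 0 1)
  calc _ = ∫⁻ s in Iic (-0 : ℝ), (∫⁻ x in Iic s, k x ∂(gaussianReal 0 1)) ^ 2
          / gaussianPDF 0 1 s := by rw [neg_zero]
    _ = ∫⁻ s in Ioi (0 : ℝ), (∫⁻ x in Ioi s, k (-x) ∂(gaussianReal 0 1)) ^ 2
          / gaussianPDF 0 1 s := by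
        rw [← hvol.setLIntegral_comp_preimage measurableSet_Iic hmeas, hpre,
          Measure.restrict_congr_set Ioi_ae_eq_Ici]
        simp only [hk' k hk, hpdf]
    _ ≤ ∫⁻ x in Ioi (0 : ℝ), k (-x) ^ 2 ∂(gaussianReal 0 1) := hardy_Ioi (hk.comp measurable_neg)
    _ = ∫⁻ x in Iic (-0 : ℝ), k x ^ 2 ∂(gaussianReal 0 1) :=
        (hk' (fun x => k x ^ 2) (hk.pow_const 2) 0).symm
    _ = _ := by rw [neg_zero]

/-- Because the total masses agree, the difference of distribution functions at `s` is bounded by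
the integral of `|ρ - c|` over either tail. The left tail is used for `s ≤ 0` and the right tail for
`s > 0`, where the respective Hardy inequality applies. -/
lemma lintegral_cdfGap_sq_le {ρ : ℝ → ℝ≥0∞} (hρ : Measurable ρ)
    (hc : ∫⁻ x, ρ x ∂(gaussianReal 0 1) ≠ ∞) :
    ∫⁻ s, cdfGap ((gaussianReal 0 1).withDensity ρ)
        ((∫⁻ x, ρ x ∂(gaussianReal 0 1)) • gaussianReal 0 1) s ^ 2 / gaussianPDF 0 1 s
      ≤ ∫⁻ x, gap (ρ x) (∫⁻ x, ρ x ∂(gaussianReal 0 1)) ^ 2 ∂(gaussianReal 0 1) := by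
  set γ := gaussianReal 0 1 with hγ
  set c := ∫⁻ x, ρ x ∂γ with hcdef
  set k : ℝ → ℝ≥0∞ := fun x => gap (ρ x) c with hkdef
  have hk : Measurable k := measurable_gap hρ measurable_const
  have hset : ∀ A, MeasurableSet A → gap ((γ.withDensity ρ) A) ((c • γ) A) ≤ ∫⁻ x in A, k x ∂γ := by
    intro A hA
    rw [withDensity_apply _ hA]
    have h : (c • γ) A = ∫⁻ x in A, c ∂γ := by simp [lintegral_const]
    rw [h]
    exact gap_lintegral_le _ hρ measurable_const
  have h1 : ∀ s, cdfGap (γ.withDensity ρ) (c • γ) s ≤ ∫⁻ x in Iic s, k x ∂γ := fun s => by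
    unfold cdfGap
    rw [gap_comm]
    exact hset _ measurableSet_Iic
  have h2 : ∀ s, cdfGap (γ.withDensity ρ) (c • γ) s ≤ ∫⁻ x in Ioi s, k x ∂γ := fun s => by
    refine le_trans ?_ (hset (Ioi s) measurableSet_Ioi)
    have : IsFiniteMeasure (γ.withDensity ρ) := isFiniteMeasure_withDensity hc
    have : IsFiniteMeasure (c • γ) := Measure.smul_finite _ hc
    have hm : (γ.withDensity ρ) (Iic s) + (γ.withDensity ρ) (Ioi s)
        = (c • γ) (Iic s) + (c • γ) (Ioi s) := by
      rw [← compl_Iic, measure_add_measure_compl measurableSet_Iic,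
        measure_add_measure_compl measurableSet_Iic]
      simp [hcdef]
    unfold cdfGap
    set x := (γ.withDensity ρ) (Iic s)
    set y := (γ.withDensity ρ) (Ioi s)
    set z := (c • γ) (Iic s)
    set w := (c • γ) (Ioi s)
    have hx : y ≠ ∞ := measure_ne_top _ _
    have hw : w ≠ ∞ := measure_ne_top _ _
    refine gap_le_of_le_of_le ?_ ?_
    · refine (ENNReal.add_le_add_iff_right hw).1 ?_
      calc z + w = x + y := hm.symm
        _ ≤ x + (w + gap y w) := by gcongr; exact le_add_gap _ _
        _ = _ := by ring
    · refine (ENNReal.add_le_add_iff_right hx).1 ?_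
      calc x + y = z + w := hm
        _ ≤ z + (y + gap y w) := by gcongr; exact le_add_gap' _ _
        _ = _ := by ring
  rw [← lintegral_add_compl _ (measurableSet_Iic (a := (0 : ℝ))),
    ← lintegral_add_compl (μ := γ) _ (measurableSet_Iic (a := (0 : ℝ))), compl_Iic]
  refine add_le_add (le_trans ?_ (hardy_Iic hk)) (le_trans ?_ (hardy_Ioi hk))
  · exact lintegral_mono fun s => by gcongr; exact h1 s
  · exact lintegral_mono fun s => by gcongr; exact h2 s

lemma measurableSet_mem_uIoc {f : ℝ → ℝ} (hf : Measurable f) :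
    MeasurableSet {p : ℝ × ℝ | p.2 ∈ uIoc (f p.1) p.1} := by
  simp only [uIoc, mem_Ioc, ofPred_and]
  exact (measurableSet_lt (by fun_prop) (by fun_prop)).inter
    (measurableSet_le (by fun_prop) (by fun_prop))

/-- Cauchy-Schwarz for the constant `1` on the interval, with the Gaussian density as weight. -/
lemma sq_edist_le_mul_lintegral (a b : ℝ) :
    edist a b ^ 2 ≤ (∫⁻ s in uIoc a b, 1 / gaussianPDF 0 1 s) * gaussianReal 0 1 (uIoc a b) := by
  have h1 : edist a b = ∫⁻ _ in uIoc a b, 1 := by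
    simp only [lintegral_const, Measure.restrict_apply MeasurableSet.univ, univ_inter, one_mul]
    rw [uIoc, Real.volume_Ioc, edist_dist, Real.dist_eq, max_sub_min_eq_abs']
  rw [h1, gaussianReal_apply _ one_ne_zero]
  simpa using sq_lintegral_le (volume.restrict (uIoc a b)) (k := fun _ => 1)
    (w := gaussianPDF 0 1) measurable_const (measurable_gaussianPDF 0 1)
    (ae_of_all _ fun x => ⟨(gaussianPDF_pos 0 one_ne_zero x).ne', gaussianPDF_ne_top⟩)

/-- The cost of the monotone rearrangement of a one-dimensional density onto the Gaussian measure of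
the same mass. -/
theorem rearrangement_gaussianReal {ρ : ℝ → ℝ≥0∞} (hρ : Measurable ρ) (hρ2 : ∀ x, 1 / 2 ≤ ρ x)
    (hc : ∫⁻ x, ρ x ∂(gaussianReal 0 1) ≠ ∞) {S : ℝ → ℝ}
    (hS : ∀ y, (∫⁻ x, ρ x ∂(gaussianReal 0 1)) * gaussianReal 0 1 (Iic (S y))
      = ∫⁻ x in Iic y, ρ x ∂(gaussianReal 0 1)) :
    ((gaussianReal 0 1).withDensity ρ).map S
        = (∫⁻ x, ρ x ∂(gaussianReal 0 1)) • gaussianReal 0 1 ∧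
      ∫⁻ y, edist (S y) y ^ 2 ∂((gaussianReal 0 1).withDensity ρ)
        ≤ 2 * ∫⁻ x, gap (ρ x) (∫⁻ x, ρ x ∂(gaussianReal 0 1)) ^ 2 ∂(gaussianReal 0 1) := by
  have hcost := lintegral_cdfGap_sq_le hρ hc
  set γ := gaussianReal 0 1 with hγ
  set c := ∫⁻ x, ρ x ∂γ with hcdef
  have : NullSingletonClass γ := nullSingletonClass_gaussianReal one_ne_zero
  have : γ.IsOpenPosMeasure := (gaussianReal_absolutelyContinuous' 0 one_ne_zero).isOpenPosMeasure
  have hc2 : 1 / 2 ≤ c := by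
    calc (1 / 2 : ℝ≥0∞) = ∫⁻ _, 1 / 2 ∂γ := by simp
      _ ≤ c := lintegral_mono hρ2
  set m := γ.withDensity ρ with hm
  set n := c • γ with hn
  have hmle : (1 / 2 : ℝ≥0∞) • γ ≤ m := by
    rw [hm, ← withDensity_const]
    exact withDensity_mono (ae_of_all _ hρ2)
  have hnle : (1 / 2 : ℝ≥0∞) • γ ≤ n := by
    refine Measure.le_iff.2 fun s _ => ?_
    simp only [hn, Measure.smul_apply, smul_eq_mul]
    gcongr
  have : IsFiniteMeasure m := isFiniteMeasure_withDensity hc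
  have : IsFiniteMeasure n := Measure.smul_finite _ hc
  have hac : ∀ {m' : Measure ℝ}, (1 / 2 : ℝ≥0∞) • γ ≤ m' → γ ≪ m' := fun h =>
    (Measure.absolutelyContinuous_smul (by simp)).trans h.absolutelyContinuous
  have : m.IsOpenPosMeasure := (hac hmle).isOpenPosMeasure
  have : n.IsOpenPosMeasure := (hac hnle).isOpenPosMeasure
  have : NullSingletonClass m := ⟨fun x =>
    withDensity_absolutelyContinuous _ _ (measure_singleton x)⟩
  have : NullSingletonClass n := ⟨fun x => by simp [hn]⟩
  have huniv : m univ = n univ := by simp [hm, hn, hcdef]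
  have hS' : ∀ y, n (Iic (S y)) = m (Iic y) := fun y => by
    rw [hm, withDensity_apply _ measurableSet_Iic, ← hS y]
    simp [hn]
  refine ⟨map_rearrangement huniv hS', le_trans ?_ (mul_le_mul_right hcost 2)⟩
  have hSm := measurable_rearrangement hS'
  set δ := cdfGap m n with hδ
  have hδm : Measurable δ := measurable_cdfGap m n
  have hpt : ∀ y, edist (S y) y ^ 2
      ≤ 2 * ∫⁻ s, (uIoc (S y) y).indicator (fun s => δ s / gaussianPDF 0 1 s) s := by
    intro y
    rw [lintegral_indicator measurableSet_uIoc]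
    refine (sq_edist_le_mul_lintegral (S y) y).trans ?_
    rw [← lintegral_mul_const' _ _ (measure_ne_top _ _), ← lintegral_const_mul' _ _ (by simp)]
    refine setLIntegral_mono' measurableSet_uIoc fun s hs => ?_
    -- Both measures dominate `γ / 2`, so the `γ`-mass of the transport interval is at most `2 δ s`
    -- for every `s` in it. The mass factor can thus be moved under the integral over `s`.
    have := le_cdfGap hS' hmle hnle (uIoc_subset_uIcc hs)
    rw [Measure.smul_apply, smul_eq_mul, one_div, ENNReal.inv_mul_le_iff (by simp)
      (by simp)] at this
    calc _ ≤ 1 / gaussianPDF 0 1 s * (2 * δ s) := by gcongr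
      _ = _ := by
        rw [div_eq_mul_inv, div_eq_mul_inv]
        ring
  have hmI : Measurable (Function.uncurry fun y s : ℝ =>
      (uIoc (S y) y).indicator (fun s => δ s / gaussianPDF 0 1 s) s) := by
    have : (Function.uncurry fun y s : ℝ =>
        (uIoc (S y) y).indicator (fun s => δ s / gaussianPDF 0 1 s) s)
        = {p : ℝ × ℝ | p.2 ∈ uIoc (S p.1) p.1}.indicator
          (fun p => δ p.2 / gaussianPDF 0 1 p.2) := by
      ext ⟨y, s⟩
      simp [indicator]
    rw [this]
    exact Measurable.indicator (by fun_prop) (measurableSet_mem_uIoc hSm)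
  calc ∫⁻ y, edist (S y) y ^ 2 ∂m
      ≤ ∫⁻ y, (2 * ∫⁻ s, (uIoc (S y) y).indicator (fun s => δ s / gaussianPDF 0 1 s) s) ∂m :=
        lintegral_mono hpt
    _ = 2 * ∫⁻ s, (∫⁻ y, (uIoc (S y) y).indicator (fun s => δ s / gaussianPDF 0 1 s) s ∂m) := by
        rw [lintegral_const_mul' _ _ (by simp), lintegral_lintegral_swap hmI.aemeasurable]
    _ ≤ 2 * ∫⁻ s, δ s ^ 2 / gaussianPDF 0 1 s := by
        gcongr with s
        have h1 : ∀ y, (uIoc (S y) y).indicator (fun s => δ s / gaussianPDF 0 1 s) s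
            = {y | s ∈ uIoc (S y) y}.indicator (fun _ => δ s / gaussianPDF 0 1 s) y := by
          intro y; simp [indicator]
        have hms : MeasurableSet {y | s ∈ uIoc (S y) y} :=
          (measurable_prodMk_right (y := s)) (measurableSet_mem_uIoc hSm)
        simp only [h1]
        rw [lintegral_indicator_const hms]
        -- After Fubini, the mass of the points transported across `s` supplies the second factor `δ
        -- s`.
        calc _ ≤ δ s / gaussianPDF 0 1 s * δ s := by
              gcongr
              exact (measure_mono (show {y | s ∈ uIoc (S y) y} ⊆ {y | s ∈ uIcc (S y) y} from
                fun y hy => uIoc_subset_uIcc hy)).trans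
                (measure_mem_uIcc_rearrangement_le huniv hS' s)
          _ = _ := by
              rw [div_eq_mul_inv, div_eq_mul_inv]
              ring

/-! ### Fibrewise rearrangement and transport in several dimensions. -/

/-- A single measurable quantile function serves all fibres at once, which makes the fibrewise
rearrangement jointly measurable. -/
lemma exists_measurable_quantile_gaussianReal :
    ∃ Q : ℝ≥0∞ → ℝ, Measurable Q ∧ ∀ v, 0 < v → v < 1 → gaussianReal 0 1 (Iic (Q v)) = v := by
  set γ := gaussianReal 0 1 with hγ
  have : NullSingletonClass γ := nullSingletonClass_gaussianReal one_ne_zero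
  have : γ.IsOpenPosMeasure := (gaussianReal_absolutelyContinuous' 0 one_ne_zero).isOpenPosMeasure
  have hinj : Function.Injective fun y => γ.real (Iic y) := fun a b hab =>
    (strictMono_measure_Iic γ).injective
      ((ENNReal.toReal_eq_toReal_iff' (measure_ne_top _ _) (measure_ne_top _ _)).1 hab)
  obtain ⟨g, hg, hgf⟩ := ((continuous_measureReal_Iic γ).measurableEmbedding
    hinj).exists_measurable_extend measurable_id fun _ => ⟨0⟩
  refine ⟨fun v => g v.toReal, hg.comp ENNReal.measurable_toReal, fun v h0 h1 => ?_⟩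
  obtain ⟨b, hb⟩ := exists_measure_Iic_eq γ h0 (by simpa using h1)
  have : g v.toReal = b := by
    rw [← hb]
    exact congrFun hgf b
  simp only [this, hb]

lemma lintegral_prod_withDensity {Ω : Type*} [MeasurableSpace Ω] (P : Measure Ω) [SFinite P]
    (γ : Measure ℝ) [SFinite γ] {ρ f : Ω × ℝ → ℝ≥0∞} (hρ : Measurable ρ) (hf : Measurable f) :
    ∫⁻ p, f p ∂((P.prod γ).withDensity ρ)
      = ∫⁻ ω, (∫⁻ y, f (ω, y) ∂(γ.withDensity fun y => ρ (ω, y))) ∂P := by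
  rw [lintegral_withDensity_eq_lintegral_mul _ hρ hf, lintegral_prod _ (hρ.mul hf).aemeasurable]
  refine lintegral_congr fun ω => ?_
  rw [lintegral_withDensity_eq_lintegral_mul _ (by fun_prop) (by fun_prop)]
  rfl

lemma sq_gap_lintegral_one_le {γ : Measure ℝ} [IsProbabilityMeasure γ] {r : ℝ → ℝ≥0∞}
    (hr : Measurable r) : gap (∫⁻ y, r y ∂γ) 1 ^ 2 ≤ ∫⁻ y, gap (r y) 1 ^ 2 ∂γ := by
  have h1 : gap (∫⁻ y, r y ∂γ) 1 ≤ ∫⁻ y, gap (r y) 1 ∂γ := by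
    simpa using gap_lintegral_le γ hr (g := fun _ => 1) measurable_const
  refine (pow_le_pow_left₀ zero_le h1 2).trans ?_
  simpa using sq_lintegral_le γ (measurable_gap hr (g := fun _ => 1) measurable_const)
    (w := fun _ => 1)
    measurable_const (ae_of_all _ fun _ => by simp)

/-- Triangle inequality through `1`, then Jensen for the distance of the mean from `1`. The constant
is `4 · 2`. -/
lemma lintegral_gap_mean_le {γ : Measure ℝ} [IsProbabilityMeasure γ] {r : ℝ → ℝ≥0∞}
    (hr : Measurable r) :
    ∫⁻ y, gap (r y) (∫⁻ y, r y ∂γ) ^ 2 ∂γ ≤ 8 * ∫⁻ y, gap (r y) 1 ^ 2 ∂γ := by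
  set c := ∫⁻ y, r y ∂γ
  have hm := measurable_gap hr (g := fun _ => 1) measurable_const
  calc ∫⁻ y, gap (r y) c ^ 2 ∂γ ≤ ∫⁻ y, 4 * (gap (r y) 1 ^ 2 + gap c 1 ^ 2) ∂γ := by
        refine lintegral_mono fun y => ?_
        refine le_trans ?_ (add_sq_le_four_mul _ _)
        gcongr
        rw [gap_comm c]
        exact gap_triangle _ _ _
    _ = 4 * (∫⁻ y, gap (r y) 1 ^ 2 ∂γ + gap c 1 ^ 2) := by
        rw [lintegral_const_mul _ (by fun_prop), lintegral_add_left (by fun_prop)]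
        simp
    _ ≤ 4 * (∫⁻ y, gap (r y) 1 ^ 2 ∂γ + ∫⁻ y, gap (r y) 1 ^ 2 ∂γ) := by
        gcongr
        exact sq_gap_lintegral_one_le hr
    _ = _ := by ring

/-- Rearranging a density on `Ω × ℝ` along the Gaussian fibres. -/
theorem exists_fibre_rearrangement {Ω : Type*} [MeasurableSpace Ω] (P : Measure Ω)
    [IsProbabilityMeasure P] {ρ : Ω × ℝ → ℝ≥0∞} (hρ : Measurable ρ) (hρ2 : ∀ p, 1 / 2 ≤ ρ p)
    (hfin : ∫⁻ p, ρ p ∂(P.prod (gaussianReal 0 1)) ≠ ∞) :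
    ∃ S : Ω × ℝ → ℝ, Measurable S ∧
      ((P.prod (gaussianReal 0 1)).withDensity ρ).map (fun p => (p.1, S p))
        = (P.withDensity fun ω => ∫⁻ y, ρ (ω, y) ∂(gaussianReal 0 1)).prod (gaussianReal 0 1) ∧
      ∫⁻ p, edist (S p) p.2 ^ 2 ∂((P.prod (gaussianReal 0 1)).withDensity ρ)
        ≤ 16 * ∫⁻ p, gap (ρ p) 1 ^ 2 ∂(P.prod (gaussianReal 0 1)) := by
  obtain ⟨Q, hQ, hQv⟩ := exists_measurable_quantile_gaussianReal
  set γ := gaussianReal 0 1 with hγ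
  set c : Ω → ℝ≥0∞ := fun ω => ∫⁻ y, ρ (ω, y) ∂γ with hcdef
  have hcm : Measurable c := hρ.lintegral_prod_right'
  have hcfin : ∀ᵐ ω ∂P, c ω ≠ ∞ := by
    rw [lintegral_prod _ hρ.aemeasurable] at hfin
    filter_upwards [ae_lt_top hcm hfin] with ω hω using hω.ne
  have hρω : ∀ ω, Measurable fun y => ρ (ω, y) := fun ω => by fun_prop
  set F : Ω × ℝ → ℝ≥0∞ := fun p => ∫⁻ x in Iic p.2, ρ (p.1, x) ∂γ with hF
  have hFm : Measurable F := by
    have : F = fun p => ∫⁻ x, {q : (Ω × ℝ) × ℝ | q.2 ≤ q.1.2}.indicator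
        (fun q => ρ (q.1.1, q.2)) (p, x) ∂γ := by
      ext p
      rw [hF]
      simp only
      rw [← lintegral_indicator measurableSet_Iic]
      rfl
    rw [this]
    refine Measurable.lintegral_prod_right' (f := {q : (Ω × ℝ) × ℝ | q.2 ≤ q.1.2}.indicator
        (fun q => ρ (q.1.1, q.2))) ?_
    exact Measurable.indicator (by fun_prop) (measurableSet_le (by fun_prop) (by fun_prop))
  -- The fibre over `ω` has mass `c ω`, so the normalised distribution function is inserted into the
  -- Gaussian quantile. Fibres of infinite mass form a null set.
  set S : Ω × ℝ → ℝ := fun p => Q (F p / c p.1) with hSdef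
  have hSm : Measurable S := hQ.comp (hFm.div (hcm.comp measurable_fst))
  have hS : ∀ ω, c ω ≠ ∞ → ∀ y, c ω * γ (Iic (S (ω, y))) = ∫⁻ x in Iic y, ρ (ω, x) ∂γ := by
    intro ω hω y
    have : NullSingletonClass γ := nullSingletonClass_gaussianReal one_ne_zero
    have : γ.IsOpenPosMeasure := (gaussianReal_absolutelyContinuous' 0 one_ne_zero).isOpenPosMeasure
    have hpos : ∀ A, γ A ≠ 0 → 0 < ∫⁻ x in A, ρ (ω, x) ∂γ := by
      intro A hA
      calc 0 < 1 / 2 * γ A := by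
            refine ENNReal.mul_pos (by simp) hA
        _ = ∫⁻ x in A, 1 / 2 ∂γ := by simp
        _ ≤ _ := lintegral_mono fun x => hρ2 _
    have hFpos : 0 < F (ω, y) := hpos _
      ((isOpen_Iio.measure_pos γ nonempty_Iio).trans_le (measure_mono Iio_subset_Iic_self)).ne'
    have hadd : F (ω, y) + ∫⁻ x in Ioi y, ρ (ω, x) ∂γ = c ω := by
      rw [← compl_Iic]
      exact lintegral_add_compl _ measurableSet_Iic
    have hFlt : F (ω, y) < c ω := by
      rw [← hadd]
      refine ENNReal.lt_add_right ?_ (hpos _ (isOpen_Ioi.measure_pos γ nonempty_Ioi).ne').ne'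
      exact ne_top_of_le_ne_top hω (hadd ▸ le_self_add)
    have hc0 : c ω ≠ 0 := (hFpos.trans hFlt).ne'
    rw [hSdef]
    simp only
    rw [hQv _ (ENNReal.div_pos hFpos.ne' hω)
      ((ENNReal.div_lt_iff (Or.inl hc0) (Or.inl hω)).2 (by simpa using hFlt)),
      ENNReal.mul_div_cancel hc0 hω]
  have hmain := fun ω (hω : c ω ≠ ∞) =>
    rearrangement_gaussianReal (hρω ω) (fun y => hρ2 _) hω (hS ω hω)
  refine ⟨S, hSm, ?_, ?_⟩
  · refine Measure.ext fun B hB => ?_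
    have hSp : Measurable fun p : Ω × ℝ => (p.1, S p) := measurable_fst.prodMk hSm
    rw [Measure.map_apply hSp hB, ← lintegral_indicator_one (hSp hB),
      lintegral_prod_withDensity P γ hρ (measurable_one.indicator (hSp hB)),
      Measure.prod_apply hB, lintegral_withDensity_eq_lintegral_mul _ hcm
        (measurable_measure_prodMk_left hB)]
    refine lintegral_congr_ae ?_
    filter_upwards [hcfin] with ω hω
    have h := (hmain ω hω).1
    have hBω : MeasurableSet (Prod.mk ω ⁻¹' B) := measurable_prodMk_left hB
    have hSω : Measurable fun y => S (ω, y) := by fun_prop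
    calc _ = ∫⁻ y, ((fun y => S (ω, y)) ⁻¹' (Prod.mk ω ⁻¹' B)).indicator 1 y
          ∂(γ.withDensity fun y => ρ (ω, y)) := rfl
      _ = (γ.withDensity fun y => ρ (ω, y)).map (fun y => S (ω, y)) (Prod.mk ω ⁻¹' B) := by
          rw [lintegral_indicator_one (hSω hBω), Measure.map_apply hSω hBω]
      _ = _ := by
          rw [h]
          rfl
  · rw [lintegral_prod_withDensity P γ hρ (by fun_prop), lintegral_prod _ (by
      exact ((measurable_gap hρ (g := fun _ => 1) measurable_const).pow_const 2).aemeasurable),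
      ← lintegral_const_mul' _ _ (by simp)]
    refine lintegral_mono_ae ?_
    filter_upwards [hcfin] with ω hω
    refine (hmain ω hω).2.trans ?_
    -- The one-dimensional bound measures deviation from the fibre mean; passing to deviation from
    -- `1` gives `16 = 2 · 8`.
    calc _ ≤ 2 * (8 * ∫⁻ y, gap (ρ (ω, y)) 1 ^ 2 ∂γ) := by
          gcongr
          exact lintegral_gap_mean_le (hρω ω)
      _ = _ := by ring

/-- A density bounded below by `1 / 2` is transported onto the standard Gaussian measure at a cost
controlled by its chi-square divergence. -/
theorem exists_transport_pi_gaussianReal (n : ℕ) : ∀ {ρ : (Fin n → ℝ) → ℝ≥0∞}, Measurable ρ →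
    (∀ x, 1 / 2 ≤ ρ x) → ∫⁻ x, ρ x ∂(Measure.pi fun _ : Fin n => gaussianReal 0 1) = 1 →
    ∃ T : (Fin n → ℝ) → Fin n → ℝ, Measurable T ∧
      ((Measure.pi fun _ : Fin n => gaussianReal 0 1).withDensity ρ).map T
        = Measure.pi (fun _ : Fin n => gaussianReal 0 1) ∧
      ∫⁻ x, ∑ i, edist (T x i) (x i) ^ 2
          ∂((Measure.pi fun _ : Fin n => gaussianReal 0 1).withDensity ρ)
        ≤ 16 * n * ∫⁻ x, gap (ρ x) 1 ^ 2 ∂(Measure.pi fun _ : Fin n => gaussianReal 0 1) := by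
  induction n with
  | zero =>
    intro ρ hρ _ h1
    refine ⟨id, measurable_id, ?_, by simp⟩
    have : ρ = 1 := by
      ext x
      have h2 : ρ = fun _ => ρ x := funext fun y => by rw [Subsingleton.elim y x]
      rw [h2] at h1
      simpa using h1
    rw [this, withDensity_one, Measure.map_id]
  | succ n ih =>
    intro ρ hρ hρ2 h1
    set P := Measure.pi fun _ : Fin n => gaussianReal 0 1 with hP
    set G := Measure.pi fun _ : Fin (n + 1) => gaussianReal 0 1 with hG
    set γ := gaussianReal 0 1 with hγ
    -- Coordinate `0` becomes the fibre, the remaining `n` coordinates the base.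
    let e : (Fin (n + 1) → ℝ) ≃ᵐ (Fin n → ℝ) × ℝ :=
      (MeasurableEquiv.piFinSuccAbove (fun _ => ℝ) 0).trans MeasurableEquiv.prodComm
    have he : MeasurePreserving e G (P.prod γ) :=
      Measure.measurePreserving_swap.comp
        (measurePreserving_piFinSuccAbove (fun _ : Fin (n + 1) => gaussianReal 0 1) 0)
    have he1 : ∀ x, e x = (fun i => x i.succ, x 0) := fun x => rfl
    have he0 : ∀ p, e.symm p 0 = p.2 := fun p => by
      have := congrArg Prod.snd (e.apply_symm_apply p)
      rwa [he1] at this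
    have hes : ∀ p i, e.symm p (Fin.succ i) = p.1 i := fun p i => by
      have := congrFun (congrArg Prod.fst (e.apply_symm_apply p)) i
      rwa [he1] at this
    set ρ' : (Fin n → ℝ) × ℝ → ℝ≥0∞ := fun p => ρ (e.symm p) with hρ'
    have hρ'm : Measurable ρ' := hρ.comp e.symm.measurable
    have hint : ∀ f : (Fin (n + 1) → ℝ) → ℝ≥0∞, ∫⁻ p, f (e.symm p) ∂(P.prod γ) = ∫⁻ x, f x ∂G :=
      fun f => by
        rw [← he.lintegral_comp_emb e.measurableEmbedding]
        simp
    have h1' : ∫⁻ p, ρ' p ∂(P.prod γ) = 1 := by rw [← h1]; exact hint ρ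
    have hmap : (G.withDensity ρ).map e = (P.prod γ).withDensity ρ' := by
      refine Measure.ext fun B hB => ?_
      rw [Measure.map_apply e.measurable hB, withDensity_apply _ hB,
        withDensity_apply _ (e.measurable hB),
        ← he.setLIntegral_comp_preimage_emb e.measurableEmbedding]
      simp [hρ']
    obtain ⟨S, hS, hSmap, hScost⟩ := exists_fibre_rearrangement P hρ'm (fun p => hρ2 _)
      (by rw [h1']; simp)
    set c : (Fin n → ℝ) → ℝ≥0∞ := fun ω => ∫⁻ y, ρ' (ω, y) ∂γ with hc
    have hcm : Measurable c := hρ'm.lintegral_prod_right'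
    have hc2 : ∀ x, 1 / 2 ≤ c x := fun x => by
      calc (1 / 2 : ℝ≥0∞) = ∫⁻ _, 1 / 2 ∂γ := by simp
        _ ≤ c x := lintegral_mono fun y => hρ2 _
    have hc1 : ∫⁻ x, c x ∂P = 1 := by
      rw [← h1', lintegral_prod _ hρ'm.aemeasurable]
    obtain ⟨R, hR, hRmap, hRcost⟩ := ih hcm hc2 hc1
    have hprob : IsProbabilityMeasure (P.withDensity c) := ⟨by simpa using hc1⟩
    -- `S` makes the fibres Gaussian and leaves the base fixed, after which the law is the product
    -- of the marginal `c` and a Gaussian. `R` then moves only the base, so the squared costs add.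
    refine ⟨fun x => e.symm (R (e x).1, S (e x)), by fun_prop, ?_, ?_⟩
    · have h3 : (fun x => e.symm (R (e x).1, S (e x)))
          = e.symm ∘ (Prod.map R id) ∘ (fun p => (p.1, S p)) ∘ e := rfl
      rw [h3, ← Measure.map_map e.symm.measurable (by fun_prop),
        ← Measure.map_map (by fun_prop) (by fun_prop), ← Measure.map_map (by fun_prop) e.measurable,
        hmap, hSmap, ← Measure.map_prod_map _ _ hR measurable_id, hRmap, Measure.map_id,
        ← he.map_eq, Measure.map_map e.symm.measurable e.measurable]
      simp
    · have hcost : ∀ x, ∑ i, edist ((e.symm (R (e x).1, S (e x))) i) (x i) ^ 2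
          = edist (S (e x)) (e x).2 ^ 2 + ∑ i, edist (R (e x).1 i) ((e x).1 i) ^ 2 := by
        intro x
        rw [Fin.sum_univ_succ]
        simp only [he0, hes]
        rfl
      have hm1 : Measurable fun p : (Fin n → ℝ) × ℝ => edist (S p) p.2 ^ 2 := by fun_prop
      have hm2 : Measurable fun p : Fin n → ℝ => ∑ i, edist (R p i) (p i) ^ 2 := by fun_prop
      have hgap : Measurable fun p => gap (ρ' p) 1 ^ 2 :=
        (measurable_gap hρ'm (g := fun _ => 1) measurable_const).pow_const 2
      have hfst : ((P.prod γ).withDensity ρ').map Prod.fst = P.withDensity c := by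
        have h4 := congrArg (Measure.map Prod.fst) hSmap
        rw [Measure.map_map measurable_fst (by fun_prop)] at h4
        rw [show (Prod.fst : (Fin n → ℝ) × ℝ → _) = Prod.fst ∘ fun p => (p.1, S p) from rfl, h4,
          Measure.map_fst_prod]
        simp
      simp only [hcost]
      rw [lintegral_add_left (show Measurable fun x => edist (S (e x)) (e x).2 ^ 2 from
        hm1.comp e.measurable)]
      calc _ = ∫⁻ p, edist (S p) p.2 ^ 2 ∂((P.prod γ).withDensity ρ')
            + ∫⁻ p, ∑ i, edist (R p i) (p i) ^ 2 ∂(P.withDensity c) := by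
            rw [← hfst, lintegral_map hm2 measurable_fst, ← hmap, lintegral_map hm1 e.measurable,
              lintegral_map (show Measurable fun p : (Fin n → ℝ) × ℝ =>
                ∑ i, edist (R p.1 i) (p.1 i) ^ 2 from hm2.comp measurable_fst) e.measurable]
        _ ≤ 16 * ∫⁻ p, gap (ρ' p) 1 ^ 2 ∂(P.prod γ)
            + 16 * n * ∫⁻ p, gap (ρ' p) 1 ^ 2 ∂(P.prod γ) := by
            refine add_le_add hScost (hRcost.trans ?_)
            gcongr
            rw [lintegral_prod _ hgap.aemeasurable]
            -- By Jensen, passing to the marginal density does not increase the chi-square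
            -- divergence.
            exact lintegral_mono fun ω => sq_gap_lintegral_one_le (by fun_prop)
        _ = _ := by
            rw [← hint fun x => gap (ρ x) 1 ^ 2]
            push_cast
            ring

/-! ### Wasserstein bounds for the Gaussian mixtures. -/

lemma W2_le_of_coupling {d : ℕ} {μ ν : Measure (Param d)} (π : Measure (Param d × Param d))
    (h1 : π.map Prod.fst = μ) (h2 : π.map Prod.snd = ν) {D : ℝ≥0∞}
    (hD : ∫⁻ p, edist p.1 p.2 ^ 2 ∂π ≤ D ^ 2) : W2 μ ν ≤ D := by
  unfold W2
  refine (ENNReal.rpow_le_rpow ((iInf₂_le π ⟨h1, h2⟩).trans hD) (by norm_num)).trans ?_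
  rw [← ENNReal.rpow_natCast, ← ENNReal.rpow_mul]
  norm_num

lemma edist_sq_le {d : ℕ} (x y : Param d) : edist x y ^ 2 ≤ 4 * (‖x‖ₑ ^ 2 + ‖y‖ₑ ^ 2) := by
  refine le_trans ?_ (add_sq_le_four_mul _ _)
  gcongr
  calc edist x y ≤ edist x 0 + edist 0 y := edist_triangle _ _ _
    _ = _ := by rw [edist_zero_right, edist_zero_left]; rfl

/-- The independent coupling already gives this crude bound. -/
lemma W2_le_of_second_moment {d : ℕ} {μ ν : Measure (Param d)} [IsProbabilityMeasure μ]
    [IsProbabilityMeasure ν] {D : ℝ≥0∞}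
    (hD : 4 * (∫⁻ x, ‖x‖ₑ ^ 2 ∂μ + ∫⁻ x, ‖x‖ₑ ^ 2 ∂ν) ≤ D ^ 2) : W2 μ ν ≤ D := by
  refine W2_le_of_coupling (μ.prod ν) (by simp [Measure.map_fst_prod])
    (by simp [Measure.map_snd_prod]) (le_trans ?_ hD)
  calc _ ≤ ∫⁻ p, 4 * (‖p.1‖ₑ ^ 2 + ‖p.2‖ₑ ^ 2) ∂(μ.prod ν) :=
        lintegral_mono fun p => edist_sq_le _ _
    _ = _ := by
        rw [lintegral_const_mul _ (by fun_prop), lintegral_add_left (by fun_prop),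
          lintegral_prod _ (by fun_prop), lintegral_prod _ (by fun_prop)]
        simp

lemma edist_sq_eq_sum {d : ℕ} (x y : Param d) : edist x y ^ 2 = ∑ i, edist (x i) (y i) ^ 2 := by
  rw [EuclideanSpace.edist_eq, ← ENNReal.rpow_natCast, ← ENNReal.rpow_mul]
  norm_num

lemma W2_withDensity_le {d : ℕ} {ρ : Param d → ℝ≥0∞} (hρ : Measurable ρ) (hρ2 : ∀ x, 1 / 2 ≤ ρ x)
    (h1 : ∫⁻ x, ρ x ∂(stdGaussian (Param d)) = 1) {D : ℝ≥0∞}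
    (hD : 16 * (d + 2 : ℕ) * ∫⁻ x, gap (ρ x) 1 ^ 2 ∂(stdGaussian (Param d)) ≤ D ^ 2) :
    W2 (stdGaussian (Param d)) ((stdGaussian (Param d)).withDensity ρ) ≤ D := by
  let e : (Fin (d + 2) → ℝ) ≃ᵐ Param d := MeasurableEquiv.toLp 2 (Fin (d + 2) → ℝ)
  set G := Measure.pi fun _ : Fin (d + 2) => gaussianReal 0 1 with hG
  have he : MeasurePreserving e G (stdGaussian (Param d)) :=
    ⟨e.measurable, map_pi_eq_stdGaussian⟩
  have hρe : Measurable fun x => ρ (e x) := hρ.comp e.measurable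
  have hint : ∀ f : Param d → ℝ≥0∞, ∫⁻ x, f (e x) ∂G = ∫⁻ p, f p ∂(stdGaussian (Param d)) :=
    fun f => he.lintegral_comp_emb e.measurableEmbedding _
  have hmap : (G.withDensity fun x => ρ (e x)).map e = (stdGaussian (Param d)).withDensity ρ := by
    refine Measure.ext fun B hB => ?_
    rw [Measure.map_apply e.measurable hB, withDensity_apply _ hB,
      withDensity_apply _ (e.measurable hB),
      ← he.setLIntegral_comp_preimage_emb e.measurableEmbedding]
  obtain ⟨T, hT, hTmap, hTcost⟩ := exists_transport_pi_gaussianReal (d + 2) hρe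
    (fun x => hρ2 _) (by rw [hint ρ, h1])
  rw [← hG] at hTmap hTcost
  have hm : Measurable fun x => (e (T x), e x) := by fun_prop
  refine W2_le_of_coupling ((G.withDensity fun x => ρ (e x)).map fun x => (e (T x), e x)) ?_ ?_
    (le_trans ?_ hD)
  · rw [Measure.map_map measurable_fst hm, ← he.map_eq]
    conv_rhs => rw [← hTmap]
    rw [Measure.map_map e.measurable hT]
    rfl
  · rw [Measure.map_map measurable_snd hm, ← hmap]
    rfl
  · rw [lintegral_map (by fun_prop) hm, ← hint fun p => gap (ρ p) 1 ^ 2]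
    simp only [edist_sq_eq_sum]
    exact hTcost

lemma lintegral_sq_stdGaussian_lt_top (d : ℕ) :
    ∫⁻ x, ‖x‖ₑ ^ 2 ∂(stdGaussian (Param d)) < ∞ := by
  have h : MemLp id 2 (stdGaussian (Param d)) := IsGaussian.memLp_two_id
  have := lintegral_rpow_enorm_lt_top_of_eLpNorm_lt_top (by simp) (by simp) h.2
  simpa using this

/-- The mixture `(1 - α⁻¹) μ₀ + α⁻¹ μ` of the standard Gaussian measure and `μ`. -/
noncomputable def mixture {d : ℕ} (α : ℝ) (μ : Measure (Param d)) : Measure (Param d) :=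
  ENNReal.ofReal (1 - α⁻¹) • stdGaussian (Param d) + ENNReal.ofReal α⁻¹ • μ

lemma ofReal_one_sub_add {α : ℝ} (hα : 1 ≤ α) :
    ENNReal.ofReal (1 - α⁻¹) + ENNReal.ofReal α⁻¹ = 1 := by
  rw [← ENNReal.ofReal_add (by simpa using inv_le_one_of_one_le₀ hα) (by positivity)]
  simp

lemma isProbabilityMeasure_mixture {d : ℕ} {α : ℝ} (hα : 1 ≤ α) (μ : Measure (Param d))
    [IsProbabilityMeasure μ] : IsProbabilityMeasure (mixture α μ) :=
  ⟨by simpa [mixture] using ofReal_one_sub_add hα⟩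

/-- The second moment of the mixture is at most the sum of those of its components, uniformly in
`α`. This gives no decay in `α`. -/
lemma exists_W2_mixture_le {d : ℕ} {μ : Measure (Param d)} (hμ : IsP2 μ) :
    ∃ D : ℝ, 0 < D ∧ ∀ α : ℝ, 1 ≤ α →
      W2 (stdGaussian (Param d)) (mixture α μ) ≤ ENNReal.ofReal D := by
  have := hμ.1
  set A := ∫⁻ x, ‖x‖ₑ ^ 2 ∂(stdGaussian (Param d)) with hA
  set B := ∫⁻ x, ‖x‖ₑ ^ 2 ∂μ with hB
  have hAB : A + B ≠ ∞ := (ENNReal.add_lt_top.2 ⟨lintegral_sq_stdGaussian_lt_top d, hμ.2⟩).ne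
  have hA' : A ≠ ∞ := (lintegral_sq_stdGaussian_lt_top d).ne
  set K := (4 * (A + (A + B))).toReal with hK
  have hfin : 4 * (A + (A + B)) ≠ ∞ := ENNReal.mul_ne_top (by simp) (by simp [hA', hAB])
  refine ⟨√K + 1, by positivity, fun α hα => ?_⟩
  have := isProbabilityMeasure_mixture hα μ
  refine W2_le_of_second_moment ?_
  have h1 : ∫⁻ x, ‖x‖ₑ ^ 2 ∂(mixture α μ) ≤ A + B := by
    rw [mixture, lintegral_add_measure, lintegral_smul_measure, lintegral_smul_measure]
    have h2 := ofReal_one_sub_add hα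
    refine add_le_add ?_ ?_
    · exact (mul_le_mul_left (h2 ▸ le_self_add : ENNReal.ofReal (1 - α⁻¹) ≤ 1) _).trans
        (by simp [hA])
    · exact (mul_le_mul_left (h2 ▸ le_add_self : ENNReal.ofReal α⁻¹ ≤ 1) _).trans (by simp [hB])
  calc _ ≤ 4 * (A + (A + B)) := by gcongr
    _ = ENNReal.ofReal K := (ENNReal.ofReal_toReal hfin).symm
    _ ≤ ENNReal.ofReal ((√K + 1) ^ 2) := by
        refine ENNReal.ofReal_le_ofReal ?_
        have h3 := Real.sq_sqrt (show 0 ≤ K from ENNReal.toReal_nonneg)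
        nlinarith [Real.sqrt_nonneg K]
    _ = _ := ENNReal.ofReal_pow (by positivity) 2

/-- Identifies the squared gap of the transport bound with the integrand of `chiSq`. -/
lemma gap_eq_ofReal {a : ℝ≥0∞} (ha : a ≠ ∞) :
    gap a 1 ^ 2 = ENNReal.ofReal ((a.toReal - 1) ^ 2) := by
  have h : gap a 1 = ENNReal.ofReal |a.toReal - 1| := by
    lift a to NNReal using ha
    unfold gap
    rw [ENNReal.coe_toReal]
    rcases le_total a 1 with h | h
    · have h' : (a : ℝ) ≤ 1 := h
      rw [tsub_eq_zero_of_le (by exact_mod_cast h), zero_add, abs_of_nonpos (by linarith), neg_sub,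
        ENNReal.ofReal_sub _ a.coe_nonneg]
      simp
    · have h' : 1 ≤ (a : ℝ) := h
      rw [tsub_eq_zero_of_le (show (1 : ℝ≥0∞) ≤ a by exact_mod_cast h), add_zero,
        abs_of_nonneg (by linarith), ENNReal.ofReal_sub _ zero_le_one]
      simp
  rw [h, ← ENNReal.ofReal_pow (abs_nonneg _), sq_abs]

lemma exists_W2_mixture_le_of_chiSq {d : ℕ} {μ : Measure (Param d)} (hμ : IsP2 μ)
    (hχ : chiSq μ (stdGaussian (Param d)) < ∞) :
    ∃ D : ℝ, 0 < D ∧ ∀ α : ℝ, 1 ≤ α →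
      W2 (stdGaussian (Param d)) (mixture α μ) ≤ ENNReal.ofReal (α⁻¹ * D) := by
  obtain ⟨D₁, hD₁, hW⟩ := exists_W2_mixture_le hμ
  have := hμ.1
  set G := stdGaussian (Param d) with hG
  have : IsProbabilityMeasure G := isProbabilityMeasure_stdGaussian
  unfold chiSq at hχ
  split_ifs at hχ with hac
  · set r := μ.rnDeriv G with hr
    have hrm : Measurable r := Measure.measurable_rnDeriv _ _
    have hL : μ.HaveLebesgueDecomposition G := Measure.haveLebesgueDecomposition_of_sigmaFinite μ G
    have hμr : G.withDensity r = μ := Measure.withDensity_rnDeriv_eq _ _ hac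
    set χ := ∫⁻ x, gap (r x) 1 ^ 2 ∂G with hχdef
    have hχfin : χ < ∞ := by
      refine lt_of_eq_of_lt (lintegral_congr_ae ?_) hχ
      filter_upwards [Measure.rnDeriv_lt_top μ G] with x hx using gap_eq_ofReal hx.ne
    set K := (16 * (d + 2 : ℕ) * χ).toReal with hK
    have hKfin : 16 * (d + 2 : ℕ) * χ ≠ ∞ :=
      ENNReal.mul_ne_top (ENNReal.mul_ne_top (by simp) (by simp)) hχfin.ne
    -- For `α ≤ 2` the density may fall below `1 / 2`, but `D₁ ≤ α⁻¹ · 2 D₁`. For `α ≥ 2` the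
    -- transport bound applies with `√K`.
    refine ⟨2 * D₁ + √K, by positivity, fun α hα => ?_⟩
    rcases le_total α 2 with h2 | h2
    · refine (hW α hα).trans (ENNReal.ofReal_le_ofReal ?_)
      have : 1 ≤ α⁻¹ * 2 := by
        rw [inv_mul_eq_div, one_le_div (by linarith)]
        exact h2
      have h3 : 0 ≤ α⁻¹ := by positivity
      nlinarith [Real.sqrt_nonneg K, mul_nonneg h3 (Real.sqrt_nonneg K)]
    · set a := ENNReal.ofReal α⁻¹ with ha
      set ρ : Param d → ℝ≥0∞ := fun x => ENNReal.ofReal (1 - α⁻¹) + a * r x with hρ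
      have hρm : Measurable ρ := by fun_prop
      have hsum : ENNReal.ofReal (1 - α⁻¹) + a = 1 := ofReal_one_sub_add hα
      have hmix : mixture α μ = G.withDensity ρ := by
        rw [hρ, show (fun x => ENNReal.ofReal (1 - α⁻¹) + a * r x)
          = (fun _ => ENNReal.ofReal (1 - α⁻¹)) + a • r from rfl,
          withDensity_add_left measurable_const, withDensity_const, withDensity_smul _ hrm, hμr]
        rfl
      have hprob := isProbabilityMeasure_mixture hα μ
      have hinv : α⁻¹ ≤ 1 / 2 := by
        rw [one_div]
        exact inv_anti₀ (by norm_num) h2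
      -- Since `ρ - 1 = α⁻¹ (r - 1)`, the chi-square divergence gains `α⁻²`, hence the distance
      -- gains `α⁻¹`.
      have hgap : ∀ x, gap (ρ x) 1 ≤ a * gap (r x) 1 := by
        intro x
        refine gap_le_of_le_of_le ?_ ?_
        · calc ρ x ≤ ENNReal.ofReal (1 - α⁻¹) + a * (1 + gap (r x) 1) := by
                simp only [hρ]
                gcongr
                exact le_add_gap _ _
            _ = (ENNReal.ofReal (1 - α⁻¹) + a) + a * gap (r x) 1 := by ring
            _ = _ := by rw [hsum]
        · calc 1 = ENNReal.ofReal (1 - α⁻¹) + a * 1 := by rw [mul_one, hsum]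
            _ ≤ ENNReal.ofReal (1 - α⁻¹) + a * (r x + gap (r x) 1) := by
                gcongr
                exact le_add_gap' _ _
            _ = _ := by simp only [hρ]; ring
      rw [hmix]
      refine W2_withDensity_le hρm (fun x => ?_) ?_ ?_
      · refine le_trans ?_ le_self_add
        rw [show (1 / 2 : ℝ≥0∞) = ENNReal.ofReal (1 / 2) by
          rw [ENNReal.ofReal_div_of_pos (by norm_num)]; simp]
        exact ENNReal.ofReal_le_ofReal (by linarith)
      · have := hprob.measure_univ
        rw [hmix] at this
        simpa using this
      · calc _ ≤ 16 * (d + 2 : ℕ) * ∫⁻ x, (a * gap (r x) 1) ^ 2 ∂G := by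
              gcongr with x
              exact hgap x
          _ = a ^ 2 * (16 * (d + 2 : ℕ) * χ) := by
              simp only [mul_pow]
              rw [lintegral_const_mul' _ _ (by simp [ha])]
              ring
          _ = a ^ 2 * ENNReal.ofReal (√K ^ 2) := by
              rw [Real.sq_sqrt ENNReal.toReal_nonneg, ENNReal.ofReal_toReal hKfin]
          _ ≤ a ^ 2 * ENNReal.ofReal ((2 * D₁ + √K) ^ 2) := by
              gcongr
              linarith
          _ = _ := by
              rw [ENNReal.ofReal_mul (by positivity), mul_pow, ENNReal.ofReal_pow (by positivity)]
  · exact absurd hχ (lt_irrefl _)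

/-! ### Ridge functions determine finite measures on bounded sets. -/

section Ridge

open scoped Convolution ContDiff RealInnerProductSpace

/-- The derivatives of a bounded nonconstant function do not vanish identically, provided they are
bounded. -/
lemma exists_derivative_ne_zero {S : ℕ → ℝ → ℝ} (hS : ∀ k x, HasDerivAt (S k) (S (k + 1) x) x)
    (hb : ∀ k, ∃ C, ∀ x, |S k x| ≤ C) {x₀ y₀ : ℝ} (hne : S 0 x₀ ≠ S 0 y₀) (k : ℕ) :
    ∃ c, S k c ≠ 0 := by
  by_contra! hk
  induction k with
  | zero => exact hne (by rw [hk, hk])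
  | succ k ih =>
    have hconst : ∀ x, S k x = S k 0 := fun x =>
      is_const_of_deriv_eq_zero (fun x => (hS k x).differentiableAt)
        (fun x => by rw [(hS k x).deriv, hk]) x 0
    rcases k with _ | k
    · exact hne (by rw [hconst x₀, hconst y₀])
    -- A nonzero constant derivative `S (k + 1)` would make `S k` affine and unbounded; so `S (k +
    -- 1)` vanishes and the previous case applies.
    · refine ih fun x => ?_
      rw [hconst x]
      obtain ⟨C, hC⟩ := hb k
      by_contra ha
      set a := S (k + 1) 0 with ha'
      have hlin : ∀ x, S k x = S k 0 + a * x := by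
        intro x
        have hd : ∀ x, HasDerivAt (fun x => S k x - a * x) 0 x := fun x =>
          ((hS k x).sub ((hasDerivAt_id x).const_mul a)).congr_deriv (by rw [hconst x]; ring)
        have h := is_const_of_deriv_eq_zero (fun x => (hd x).differentiableAt)
          (fun x => (hd x).deriv) x 0
        simp only [mul_zero, sub_zero] at h
        linarith
      -- At this point `S k` differs from `S k 0` by `2 * C + 1`, more than the bound `C` permits.
      have h1 := hC ((2 * C + 1) / a)
      have h2 := hC 0
      rw [hlin, mul_div_cancel₀ _ ha] at h1
      rw [abs_le] at h1 h2
      linarith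

/-- A bounded nonconstant continuous function has a smooth bounded nonconstant mollification. -/
lemma exists_mollification {σ : ℝ → ℝ} (hσ : Continuous σ) {C : ℝ} (hC : ∀ s, |σ s| ≤ C)
    {x₀ y₀ : ℝ} (hne : σ x₀ ≠ σ y₀) :
    ∃ (φ : ℝ → ℝ) (S : ℕ → ℝ → ℝ), Continuous φ ∧ Integrable φ ∧
      (∀ x, S 0 x = ∫ t, φ t * σ (x - t)) ∧ (∀ k x, HasDerivAt (S k) (S (k + 1) x) x) ∧
      (∀ k, ∃ C, ∀ x, |S k x| ≤ C) ∧ S 0 x₀ ≠ S 0 y₀ := by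
  -- Mollification changes each of the two values by at most `ε`, a third of their distance, so they
  -- stay distinct.
  set ε := |σ x₀ - σ y₀| / 3 with hε
  have hεpos : 0 < ε := by
    have := abs_pos.2 (sub_ne_zero.2 hne)
    positivity
  obtain ⟨δ₁, hδ₁, h₁⟩ := Metric.continuous_iff.1 hσ x₀ ε hεpos
  obtain ⟨δ₂, hδ₂, h₂⟩ := Metric.continuous_iff.1 hσ y₀ ε hεpos
  set δ := min δ₁ δ₂ with hδ
  have hδpos : 0 < δ := lt_min hδ₁ hδ₂
  let B : ContDiffBump (0 : ℝ) := ⟨δ / 2, δ, by positivity, by linarith⟩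
  set φ : ℝ → ℝ := B.normed volume with hφ
  have hφs : ContDiff ℝ ∞ φ := B.contDiff_normed
  have hφc : HasCompactSupport φ := B.hasCompactSupport_normed
  have hks : ∀ k, ContDiff ℝ 1 (iteratedDeriv k φ) := fun k =>
    (hφs.of_le (by exact_mod_cast le_top)).iterate_deriv' 1 k |> fun h => by
      rwa [← iteratedDeriv_eq_iterate] at h
  have hkc : ∀ k, HasCompactSupport (iteratedDeriv k φ) := fun k => by
    induction k with
    | zero => simpa using hφc
    | succ k ih => rw [iteratedDeriv_succ]; exact ih.deriv
  have hki : ∀ k, Integrable (iteratedDeriv k φ) := fun k =>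
    (hks k).continuous.integrable_of_hasCompactSupport (hkc k)
  set S : ℕ → ℝ → ℝ := fun k =>
    (iteratedDeriv k φ) ⋆[ContinuousLinearMap.lsmul ℝ ℝ, volume] σ with hSdef
  have hSx : ∀ k x, S k x = ∫ t, iteratedDeriv k φ t * σ (x - t) := fun k x => rfl
  have hclose : ∀ z, (∀ y, dist y z < δ → dist (σ y) (σ z) < ε) → dist (S 0 z) (σ z) ≤ ε := by
    intro z hz
    have : S 0 = φ ⋆[ContinuousLinearMap.lsmul ℝ ℝ, volume] σ := by simp [hSdef]
    rw [this]
    exact B.dist_normed_convolution_le hσ.aestronglyMeasurable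
      fun y hy => (hz y (Metric.mem_ball.1 hy)).le
  refine ⟨φ, S, hφs.continuous, by simpa using hki 0, fun x => by simpa using hSx 0 x,
    fun k x => ?_, fun k => ⟨(∫ t, |iteratedDeriv k φ t|) * C, fun x => ?_⟩, ?_⟩
  · have h := (hkc k).hasDerivAt_convolution_left (ContinuousLinearMap.lsmul ℝ ℝ) (μ := volume)
      (hks k) hσ.locallyIntegrable x
    rwa [← iteratedDeriv_succ] at h
  · rw [hSx, ← integral_mul_const, ← Real.norm_eq_abs]
    refine norm_integral_le_of_norm_le ((hki k).abs.mul_const C) (ae_of_all _ fun t => ?_)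
    rw [Real.norm_eq_abs, abs_mul]
    exact mul_le_mul_of_nonneg_left (hC _) (abs_nonneg _)
  · have e1 := hclose x₀ fun y hy => h₁ y (hy.trans_le (min_le_left _ _))
    have e2 := hclose y₀ fun y hy => h₂ y (hy.trans_le (min_le_right _ _))
    intro h
    rw [h, Real.dist_eq, abs_sub_comm] at e1
    rw [Real.dist_eq] at e2
    have := abs_sub_le (σ x₀) (S 0 y₀) (σ y₀)
    linarith

variable {n : ℕ} {K : Set (EuclideanSpace ℝ (Fin n))}

lemma exists_abs_inner_le (hK : Bornology.IsBounded K) (w : EuclideanSpace ℝ (Fin n)) :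
    ∃ R, 0 ≤ R ∧ ∀ z : K, |⟪w, (z : EuclideanSpace ℝ (Fin n))⟫| ≤ R := by
  obtain ⟨R, hR⟩ := hK.exists_norm_le
  refine ⟨‖w‖ * max R 0, by positivity, fun z => ?_⟩
  refine (abs_real_inner_le_norm _ _).trans ?_
  gcongr
  exact (hR _ z.2).trans (le_max_left _ _)

lemma integrable_of_bounded_of_measurable {α : Type*} [MeasurableSpace α] (m : Measure α)
    [IsFiniteMeasure m] {f : α → ℝ} (hf : Measurable f) {C : ℝ} (hC : ∀ x, |f x| ≤ C) :
    Integrable f m :=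
  Integrable.of_bound hf.aestronglyMeasurable C (ae_of_all _ hC)

/-- Finite measures on a bounded set are determined by the moments of their projections. -/
lemma ext_of_inner_moments (hK : Bornology.IsBounded K) {m₁ m₂ : Measure K} [IsFiniteMeasure m₁]
    [IsFiniteMeasure m₂] (h : ∀ (w : EuclideanSpace ℝ (Fin n)) (k : ℕ),
      ∫ z : K, ⟪w, (z : EuclideanSpace ℝ (Fin n))⟫ ^ k ∂m₁
        = ∫ z : K, ⟪w, (z : EuclideanSpace ℝ (Fin n))⟫ ^ k ∂m₂) : m₁ = m₂ := by
  have hseries : ∀ (m : Measure K) [IsFiniteMeasure m] (w : EuclideanSpace ℝ (Fin n)),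
      HasSum (fun k : ℕ => Complex.I ^ k / (k.factorial : ℂ)
        * ((∫ z : K, ⟪w, (z : EuclideanSpace ℝ (Fin n))⟫ ^ k ∂m : ℝ) : ℂ))
        (charFun (m.map Subtype.val) w) := by
    intro m _ w
    obtain ⟨R, hR0, hR⟩ := exists_abs_inner_le hK w
    rw [charFun_apply, integral_map (by fun_prop) (by fun_prop)]
    have hm : ∀ k : ℕ, Measurable fun z : K => ⟪w, (z : EuclideanSpace ℝ (Fin n))⟫ ^ k :=
      fun k => by fun_prop
    have hi : ∀ k : ℕ, Integrable (fun z : K => ⟪w, (z : EuclideanSpace ℝ (Fin n))⟫ ^ k) m :=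
      fun k => integrable_of_bounded_of_measurable m (hm k) (C := R ^ k) fun z => by
        rw [abs_pow]; gcongr; exact hR z
    -- The exponential series is integrated termwise; projections of the bounded set lie in `[-R,
    -- R]`, so the series of `R ^ k / k!` dominates.
    have hs := hasSum_integral_of_summable_integral_norm (μ := m)
      (F := fun (k : ℕ) (z : K) => Complex.I ^ k / (k.factorial : ℂ)
        * ((⟪w, (z : EuclideanSpace ℝ (Fin n))⟫ ^ k : ℝ) : ℂ))
      (fun k => (hi k).ofReal.const_mul _) (by
        refine Summable.of_nonneg_of_le (fun k => integral_nonneg fun z => norm_nonneg _)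
          (fun k => ?_) ((Real.summable_pow_div_factorial R).mul_right (m.real univ))
        refine (integral_mono_of_nonneg (ae_of_all _ fun z => norm_nonneg _)
          (integrable_const (R ^ k / k.factorial)) (ae_of_all _ fun z => ?_)).trans ?_
        · simp only [norm_mul, norm_div, norm_pow, Complex.norm_I, one_pow, Complex.norm_real,
            Complex.norm_natCast, Real.norm_eq_abs]
          rw [one_div_mul_eq_div]
          gcongr
          exact hR z
        · simp [mul_comm])
    have h1 : ∀ k : ℕ, ∫ z : K, Complex.I ^ k / (k.factorial : ℂ)
        * ((⟪w, (z : EuclideanSpace ℝ (Fin n))⟫ ^ k : ℝ) : ℂ) ∂m = Complex.I ^ k / (k.factorial : ℂ)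
        * ((∫ z : K, ⟪w, (z : EuclideanSpace ℝ (Fin n))⟫ ^ k ∂m : ℝ) : ℂ) := fun k => by
      rw [integral_const_mul, integral_complex_ofReal]
    have h2 : ∀ z : K, ∑' k : ℕ, Complex.I ^ k / (k.factorial : ℂ)
        * ((⟪w, (z : EuclideanSpace ℝ (Fin n))⟫ ^ k : ℝ) : ℂ)
        = Complex.exp (⟪(z : EuclideanSpace ℝ (Fin n)), w⟫ * Complex.I) := fun z => by
      rw [Complex.exp_eq_exp_ℂ, NormedSpace.exp_eq_tsum_div]
      refine tsum_congr fun k => ?_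
      rw [real_inner_comm, mul_pow]
      push_cast
      ring
    simp only [h1, h2] at hs
    exact hs
  have hmap : m₁.map Subtype.val = m₂.map (Subtype.val : K → EuclideanSpace ℝ (Fin n)) := by
    refine Measure.ext_of_charFun (funext fun w => ?_)
    refine (hseries m₁ w).unique ?_
    simp only [h w]
    exact hseries m₂ w
  refine Measure.ext fun A hA => ?_
  obtain ⟨B, hB, rfl⟩ := hA
  rw [← Measure.map_apply measurable_subtype_coe hB, hmap,
    Measure.map_apply measurable_subtype_coe hB]

/-- Universal approximation in dual form: finite measures on a bounded set that agree on all ridge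
functions of a bounded nonconstant profile are equal. -/
theorem ext_of_ridge (hK : Bornology.IsBounded K) {σ : ℝ → ℝ} (hσ : Continuous σ) {C : ℝ}
    (hC : ∀ s, |σ s| ≤ C) {x₀ y₀ : ℝ} (hne : σ x₀ ≠ σ y₀) {m₁ m₂ : Measure K} [IsFiniteMeasure m₁]
    [IsFiniteMeasure m₂] (h : ∀ (w : EuclideanSpace ℝ (Fin n)) (c : ℝ),
      ∫ z : K, σ (⟪w, (z : EuclideanSpace ℝ (Fin n))⟫ + c) ∂m₁
        = ∫ z : K, σ (⟪w, (z : EuclideanSpace ℝ (Fin n))⟫ + c) ∂m₂) : m₁ = m₂ := by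
  obtain ⟨φ, S, hφ, hφi, hS0, hS, hb, hSne⟩ := exists_mollification hσ hC hne
  have hSc : ∀ k, Continuous (S k) := fun k =>
    continuous_iff_continuousAt.2 fun x => (hS k x).continuousAt
  -- By Fubini, ridge integrals of the mollified profile are averages over the bias of those of `σ`,
  -- so they agree too.
  have hfub : ∀ (m : Measure K) [IsFiniteMeasure m] (w : EuclideanSpace ℝ (Fin n)) (c : ℝ),
      ∫ z : K, S 0 (⟪w, (z : EuclideanSpace ℝ (Fin n))⟫ + c) ∂m
        = ∫ t, φ t * ∫ z : K, σ (⟪w, (z : EuclideanSpace ℝ (Fin n))⟫ + (c - t)) ∂m := by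
    intro m _ w c
    simp only [hS0]
    rw [integral_integral_swap]
    · refine integral_congr_ae (ae_of_all _ fun t => ?_)
      simp only
      rw [integral_const_mul]
      simp only [add_sub_assoc]
    · refine Integrable.mono' (g := fun p : K × ℝ => C * |φ p.2|) ?_ ?_ ?_
      · exact ((hφi.abs.comp_snd m)).const_mul C
      · have : Continuous (Function.uncurry fun (z : K) (t : ℝ) =>
            φ t * σ (⟪w, (z : EuclideanSpace ℝ (Fin n))⟫ + c - t)) := by fun_prop
        exact this.aestronglyMeasurable
      · refine ae_of_all _ fun p => ?_
        simp only [Function.uncurry, Real.norm_eq_abs, abs_mul]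
        rw [mul_comm]
        exact mul_le_mul_of_nonneg_right (hC _) (abs_nonneg _)
  -- Each derivative in the dilation `t` produces one more factor `⟪w, z⟫` and raises the order of
  -- `S`.
  have hmom : ∀ (k : ℕ) (w : EuclideanSpace ℝ (Fin n)) (c t : ℝ),
      ∫ z : K, ⟪w, (z : EuclideanSpace ℝ (Fin n))⟫ ^ k
          * S k (t * ⟪w, (z : EuclideanSpace ℝ (Fin n))⟫ + c) ∂m₁
        = ∫ z : K, ⟪w, (z : EuclideanSpace ℝ (Fin n))⟫ ^ k
          * S k (t * ⟪w, (z : EuclideanSpace ℝ (Fin n))⟫ + c) ∂m₂ := by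
    intro k
    induction k with
    | zero =>
      intro w c t
      have h1 := hfub m₁ (t • w) c
      have h2 := hfub m₂ (t • w) c
      simp only [h] at h1
      rw [← h2] at h1
      simpa [real_inner_smul_left] using h1
    | succ k ih =>
      intro w c t
      obtain ⟨R, hR0, hR⟩ := exists_abs_inner_le hK w
      have hder : ∀ (m : Measure K) [IsFiniteMeasure m],
          HasDerivAt (fun t => ∫ z : K, ⟪w, (z : EuclideanSpace ℝ (Fin n))⟫ ^ k
            * S k (t * ⟪w, (z : EuclideanSpace ℝ (Fin n))⟫ + c) ∂m)
          (∫ z : K, ⟪w, (z : EuclideanSpace ℝ (Fin n))⟫ ^ (k + 1)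
            * S (k + 1) (t * ⟪w, (z : EuclideanSpace ℝ (Fin n))⟫ + c) ∂m) t := by
        intro m _
        obtain ⟨A, hA⟩ := hb k
        obtain ⟨A', hA'⟩ := hb (k + 1)
        refine (hasDerivAt_integral_of_dominated_loc_of_deriv_le (μ := m)
          (bound := fun _ => R ^ (k + 1) * A')
          (F' := fun t z => ⟪w, (z : EuclideanSpace ℝ (Fin n))⟫ ^ (k + 1)
            * S (k + 1) (t * ⟪w, (z : EuclideanSpace ℝ (Fin n))⟫ + c))
          univ_mem (Eventually.of_forall fun t => ?_) ?_ ?_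
          (ae_of_all _ fun z t _ => ?_) (integrable_const _) (ae_of_all _ fun z t _ => ?_)).2
        · have := hSc k
          exact Continuous.aestronglyMeasurable (by fun_prop)
        · have := hSc k
          refine integrable_of_bounded_of_measurable m (C := R ^ k * A)
            (Continuous.measurable (by fun_prop)) fun z => ?_
          rw [abs_mul, abs_pow]
          have h1 := hR z
          have h2 := hA (t * ⟪w, (z : EuclideanSpace ℝ (Fin n))⟫ + c)
          gcongr
        · have := hSc (k + 1)
          exact Continuous.aestronglyMeasurable (by fun_prop)
        · rw [Real.norm_eq_abs, abs_mul, abs_pow]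
          have h1 := hR z
          have h2 := hA' (t * ⟪w, (z : EuclideanSpace ℝ (Fin n))⟫ + c)
          gcongr
        · have hin : HasDerivAt (fun t : ℝ => t * ⟪w, (z : EuclideanSpace ℝ (Fin n))⟫ + c)
              ⟪w, (z : EuclideanSpace ℝ (Fin n))⟫ t := by
            simpa using ((hasDerivAt_id t).mul_const _).add_const c
          refine (((hS k _).comp t hin).const_mul _).congr_deriv ?_
          ring
      have h1 := hder m₁
      simp only [ih w c] at h1
      exact h1.unique (hder m₂)
  refine ext_of_inner_moments hK fun w k => ?_
  obtain ⟨c, hc⟩ := exists_derivative_ne_zero hS hb hSne k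
  -- At `t = 0` the profile factor is the constant `S k c ≠ 0` and can be cancelled, leaving the
  -- `k`-th moment.
  have := hmom k w c 0
  simp only [zero_mul, zero_add, integral_mul_const] at this
  exact mul_right_cancel₀ hc this

end Ridge

/-! ### Neurons, their gradients and their profiles. -/

open scoped RealInnerProductSpace

/-- The preactivation `θ̃ᵀ (w, 1)`. -/
noncomputable def preact {d : ℕ} (w : EuclideanSpace ℝ (Fin d)) (θ : Param d) : ℝ :=
  (∑ i : Fin d, θ i.castSucc.succ * w i) + θ (Fin.last (d + 1))

lemma neuron_eq (b σ : ℝ → ℝ) {d : ℕ} (w : EuclideanSpace ℝ (Fin d)) (θ : Param d) :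
    neuron b σ w θ = b (θ 0) * σ (preact w θ) := rfl

/-- The parameter with output weight `β`, hidden weights `w` and bias `c`. -/
noncomputable def mkParam {d : ℕ} (β : ℝ) (w : EuclideanSpace ℝ (Fin d)) (c : ℝ) : Param d :=
  WithLp.toLp 2 (Fin.cons β (Fin.snoc (α := fun _ => ℝ) w c : Fin (d + 1) → ℝ))

lemma mkParam_zero {d : ℕ} (β : ℝ) (w : EuclideanSpace ℝ (Fin d)) (c : ℝ) :
    mkParam β w c 0 = β := rfl

lemma mkParam_castSucc_succ {d : ℕ} (β : ℝ) (w : EuclideanSpace ℝ (Fin d)) (c : ℝ) (i : Fin d) :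
    mkParam β w c i.castSucc.succ = w i := by
  simp [mkParam]

lemma mkParam_last {d : ℕ} (β : ℝ) (w : EuclideanSpace ℝ (Fin d)) (c : ℝ) :
    mkParam β w c (Fin.last (d + 1)) = c := by
  rw [← Fin.succ_last]
  simp [mkParam]

lemma preact_mkParam {d : ℕ} (z : EuclideanSpace ℝ (Fin d)) (β : ℝ) (w : EuclideanSpace ℝ (Fin d))
    (c : ℝ) : preact z (mkParam β w c) = ⟪w, z⟫ + c := by
  simp only [preact, mkParam_castSucc_succ, mkParam_last, PiLp.inner_apply]
  simp [mul_comm]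

lemma forall_fin_add_two {d : ℕ} {p : Fin (d + 2) → Prop} (h0 : p 0)
    (h1 : ∀ i : Fin d, p i.castSucc.succ) (h2 : p (Fin.last (d + 1))) : ∀ i, p i := by
  refine Fin.cases h0 fun j => ?_
  refine Fin.lastCases (motive := fun j => p j.succ) ?_ (fun i => h1 i) j
  rwa [Fin.succ_last]

lemma differentiable_mkParam_left {d : ℕ} (w : EuclideanSpace ℝ (Fin d)) (c : ℝ) :
    Differentiable ℝ fun β => mkParam β w c := by
  refine differentiable_euclidean.2 (forall_fin_add_two ?_ (fun i => ?_) ?_)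
  · exact differentiable_id
  · simp only [mkParam_castSucc_succ]; fun_prop
  · simp only [mkParam_last]; fun_prop

lemma differentiable_mkParam_right {d : ℕ} (β : ℝ) (w : EuclideanSpace ℝ (Fin d)) :
    Differentiable ℝ fun c => mkParam β w c := by
  refine differentiable_euclidean.2 (forall_fin_add_two ?_ (fun i => ?_) ?_)
  · simp only [mkParam_zero]; fun_prop
  · simp only [mkParam_castSucc_succ]; fun_prop
  · simp only [mkParam_last]; fun_prop

lemma preact_add_smul {d : ℕ} (w : EuclideanSpace ℝ (Fin d)) (θ e : Param d) (t : ℝ) :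
    preact w (θ + t • e) = preact w θ + t * preact w e := by
  simp only [preact, PiLp.add_apply, PiLp.smul_apply, smul_eq_mul, mul_add, Finset.mul_sum, add_mul,
    Finset.sum_add_distrib]
  simp only [mul_assoc]
  ring

lemma hasDerivAt_neuron_line {b σ : ℝ → ℝ} {d : ℕ} {w : EuclideanSpace ℝ (Fin d)}
    (h : Differentiable ℝ (neuron b σ w)) (θ e : Param d) (t : ℝ) :
    HasDerivAt (fun t : ℝ => neuron b σ w (θ + t • e))
      ⟪gradient (neuron b σ w) (θ + t • e), e⟫ t := by
  have h1 := (h (θ + t • e)).hasGradientAt.hasFDerivAt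
  have h2 : HasDerivAt (fun t : ℝ => θ + t • e) e t := by
    simpa using ((hasDerivAt_id t).smul_const e).const_add θ
  have h3 := h1.comp_hasDerivAt t h2
  rw [InnerProductSpace.toDual_apply_apply] at h3
  exact h3

/-- The properties of the output nonlinearity `b` and the activation `σ` that follow from the
regularity of the neurons. -/
structure ProfileRegular (b σ : ℝ → ℝ) : Prop where
  differentiable_output : Differentiable ℝ b
  differentiable_activation : Differentiable ℝ σ
  continuous_deriv : Continuous (deriv σ)
  bounded : ∃ C, ∀ s, |σ s| ≤ C
  nonconstant : ∃ x y, σ x ≠ σ y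
  deriv_output_ne_zero : ∃ β, deriv b β ≠ 0

lemma hasDerivAt_neuron_line' {b σ : ℝ → ℝ} (hb : Differentiable ℝ b) (hσ : Differentiable ℝ σ)
    {d : ℕ} (w : EuclideanSpace ℝ (Fin d)) (θ e : Param d) :
    HasDerivAt (fun t : ℝ => neuron b σ w (θ + t • e))
      (deriv b (θ 0) * e 0 * σ (preact w θ) + b (θ 0) * (deriv σ (preact w θ) * preact w e)) 0 := by
  simp only [neuron_eq, preact_add_smul, PiLp.add_apply, PiLp.smul_apply, smul_eq_mul]
  have h1 : HasDerivAt (fun t : ℝ => θ 0 + t * e 0) (e 0) 0 := by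
    simpa using ((hasDerivAt_id (0 : ℝ)).mul_const (e 0)).const_add (θ 0)
  have h2 : HasDerivAt (fun t : ℝ => preact w θ + t * preact w e) (preact w e) 0 := by
    simpa using ((hasDerivAt_id (0 : ℝ)).mul_const (preact w e)).const_add (preact w θ)
  have hb' : HasDerivAt b (deriv b (θ 0)) (θ 0 + 0 * e 0) := by simpa using (hb _).hasDerivAt
  have hσ' : HasDerivAt σ (deriv σ (preact w θ)) (preact w θ + 0 * preact w e) := by
    simpa using (hσ _).hasDerivAt
  refine ((hb'.comp (0 : ℝ) h1).mul (hσ'.comp (0 : ℝ) h2)).congr_deriv ?_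
  simp

lemma inner_gradient_neuron {b σ : ℝ → ℝ} (hb : Differentiable ℝ b) (hσ : Differentiable ℝ σ)
    {d : ℕ} {w : EuclideanSpace ℝ (Fin d)} (h : Differentiable ℝ (neuron b σ w)) (θ e : Param d) :
    ⟪gradient (neuron b σ w) θ, e⟫
      = deriv b (θ 0) * e 0 * σ (preact w θ) + b (θ 0) * (deriv σ (preact w θ) * preact w e) := by
  have h1 := hasDerivAt_neuron_line h θ e 0
  rw [zero_smul, add_zero] at h1
  exact h1.unique (hasDerivAt_neuron_line' hb hσ w θ e)

lemma preact_single_last {d : ℕ} (w : EuclideanSpace ℝ (Fin d)) :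
    preact w (EuclideanSpace.single (Fin.last (d + 1)) (1 : ℝ)) = 1 := by
  simp only [preact]
  rw [Finset.sum_eq_zero]
  · simp
  · intro i _
    have : i.castSucc.succ ≠ Fin.last (d + 1) := by
      rw [← Fin.succ_last]
      exact fun h => (Fin.castSucc_lt_last i).ne (Fin.succ_injective _ h)
    simp [this]

lemma preact_single_zero {d : ℕ} (w : EuclideanSpace ℝ (Fin d)) :
    preact w (EuclideanSpace.single 0 (1 : ℝ)) = 0 := by
  simp only [preact]
  rw [Finset.sum_eq_zero]
  · simp [Fin.last_eq_zero_iff]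
  · intro i _
    simp

lemma inner_gradient_neuron_single_zero {b σ : ℝ → ℝ} (hb : Differentiable ℝ b)
    (hσ : Differentiable ℝ σ) {d : ℕ} {w : EuclideanSpace ℝ (Fin d)}
    (h : Differentiable ℝ (neuron b σ w)) (θ : Param d) :
    ⟪gradient (neuron b σ w) θ, EuclideanSpace.single 0 (1 : ℝ)⟫
      = deriv b (θ 0) * σ (preact w θ) := by
  rw [inner_gradient_neuron hb hσ h, preact_single_zero]
  simp

/-- With zero hidden weights the neuron is `b(β) σ(s)` at any input. Fixing one factor at a nonzero
value transfers the regularity of the neuron to `b` and to `σ` separately; `b` is nonconstant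
because of its range. -/
lemma NeuronRegular.profileRegular {b σ : ℝ → ℝ} {B₀ B₁ B₂ : ℝ} {d : ℕ}
    {S : Set (EuclideanSpace ℝ (Fin d))} (h : NeuronRegular b σ B₀ B₁ B₂ S) (hB₀ : 0 < B₀)
    (hrange : Set.range b = Set.Ioo (-B₀) B₀) (hσ : ¬ ∃ P : Polynomial ℝ, ∀ s, σ s = P.eval s)
    {z : EuclideanSpace ℝ (Fin d)} (hz : z ∈ S) : ProfileRegular b σ := by
  have hval : ∀ β s, neuron b σ z (mkParam β 0 s) = b β * σ s := fun β s => by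
    rw [neuron_eq, preact_mkParam, mkParam_zero]
    simp
  have hsur : ∀ y, -B₀ < y → y < B₀ → ∃ β, b β = y := fun y h1 h2 => by
    have : y ∈ Set.range b := hrange ▸ ⟨h1, h2⟩
    exact this
  obtain ⟨β₁, hβ₁⟩ := hsur (B₀ / 2) (by linarith) (by linarith)
  obtain ⟨β₀, hβ₀⟩ := hsur 0 (by linarith) (by linarith)
  have hb1 : b β₁ ≠ 0 := by rw [hβ₁]; positivity
  have hnc : ∃ x y, σ x ≠ σ y := by
    by_contra! hc
    exact hσ ⟨Polynomial.C (σ 0), fun s => by rw [Polynomial.eval_C, hc s 0]⟩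
  obtain ⟨s₁, hs₁⟩ : ∃ s, σ s ≠ 0 := by
    by_contra! hc
    obtain ⟨x, y, hxy⟩ := hnc
    exact hxy (by rw [hc, hc])
  have hbd : Differentiable ℝ b := by
    have : b = fun β => neuron b σ z (mkParam β 0 s₁) / σ s₁ := by
      ext β
      rw [hval, mul_div_cancel_right₀ _ hs₁]
    rw [this]
    exact ((h.differentiable z hz).comp (differentiable_mkParam_left 0 s₁)).div_const _
  have hσd : Differentiable ℝ σ := by
    have : σ = fun s => neuron b σ z (mkParam β₁ 0 s) / b β₁ := by
      ext s
      rw [hval, mul_div_cancel_left₀ _ hb1]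
    rw [this]
    exact ((h.differentiable z hz).comp (differentiable_mkParam_right β₁ 0)).div_const _
  refine ⟨hbd, hσd, ?_, ⟨B₀ / |b β₁|, fun s => ?_⟩, hnc, ?_⟩
  -- The bias component of the gradient is `b(β₁) σ'(s)`, and the gradient is continuous because it
  -- is differentiable.
  · have : deriv σ = fun s => ⟪gradient (neuron b σ z) (mkParam β₁ 0 s),
        EuclideanSpace.single (Fin.last (d + 1)) (1 : ℝ)⟫ / b β₁ := by
      ext s
      rw [inner_gradient_neuron hbd hσd (h.differentiable z hz), preact_single_last,
        preact_mkParam, mkParam_zero]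
      simp [hb1]
    rw [this]
    have h1 := (h.differentiable_gradient z hz).continuous.comp
      (differentiable_mkParam_right (d := d) β₁ 0).continuous
    exact (h1.inner continuous_const).div_const _
  · rw [le_div_iff₀ (abs_pos.2 hb1), ← abs_mul, mul_comm, ← hval]
    exact h.bound z hz _
  · by_contra! hc
    have := is_const_of_deriv_eq_zero hbd hc β₀ β₁
    rw [hβ₀, hβ₁] at this
    linarith

/-! ### Mean-field networks. -/

section Net

variable {b σ : ℝ → ℝ} {B₀ B₁ B₂ : ℝ} {d : ℕ} {S : Set (EuclideanSpace ℝ (Fin d))}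

lemma ProfileRegular.continuous_neuron (hp : ProfileRegular b σ) :
    Continuous fun p : EuclideanSpace ℝ (Fin d) × Param d => neuron b σ p.1 p.2 := by
  have h1 := hp.differentiable_output.continuous
  have h2 := hp.differentiable_activation.continuous
  unfold neuron
  fun_prop

/-- `NeuronRegular` controls the parameter only; regularity in the input comes from the explicit
gradient formula. -/
lemma continuous_gradient_neuron (hp : ProfileRegular b σ) (hS : NeuronRegular b σ B₀ B₁ B₂ S)
    (θ e : Param d) :
    Continuous fun w : S => ⟪gradient (neuron b σ (w : EuclideanSpace ℝ (Fin d))) θ, e⟫ := by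
  have h : (fun w : S => ⟪gradient (neuron b σ (w : EuclideanSpace ℝ (Fin d))) θ, e⟫)
      = fun w : S => deriv b (θ 0) * e 0 * σ (preact w θ)
        + b (θ 0) * (deriv σ (preact w θ) * preact w e) := funext fun w =>
    inner_gradient_neuron hp.differentiable_output hp.differentiable_activation
      (hS.differentiable w w.2) θ e
  rw [h]
  have h1 := hp.continuous_deriv
  have h2 := hp.differentiable_activation.continuous
  unfold preact
  fun_prop

lemma integrable_neuron (hS : NeuronRegular b σ B₀ B₁ B₂ S)
    (μ : Measure (Param d)) [IsFiniteMeasure μ] (w : S) :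
    Integrable (neuron b σ (w : EuclideanSpace ℝ (Fin d))) μ :=
  integrable_of_bounded_of_measurable μ
    (hS.differentiable w w.2).continuous.measurable (hS.bound w w.2)

lemma measurable_net (hp : ProfileRegular b σ) (α : ℝ) (μ : Measure (Param d)) [SFinite μ] :
    Measurable (net b σ S α μ) := by
  have h : StronglyMeasurable fun p : S × Param d =>
      neuron b σ (p.1 : EuclideanSpace ℝ (Fin d)) p.2 :=
    (hp.continuous_neuron.comp (by fun_prop :
      Continuous fun p : S × Param d => ((p.1 : EuclideanSpace ℝ (Fin d)), p.2))).stronglyMeasurable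
  exact (h.integral_prod_right'.measurable).const_mul α

lemma abs_net_le (hS : NeuronRegular b σ B₀ B₁ B₂ S) (α : ℝ) (μ : Measure (Param d))
    [IsProbabilityMeasure μ] (w : S) : |net b σ S α μ w| ≤ |α| * B₀ := by
  unfold net
  rw [abs_mul]
  gcongr
  simpa using norm_integral_le_of_norm_le_const (μ := μ) (ae_of_all _ fun θ =>
    (Real.norm_eq_abs _).le.trans (hS.bound w w.2 θ))

/-- Together with `isP2_dirac`, this places single neurons in the primal class. -/
lemma net_dirac (θ : Param d) :
    net b σ S 1 (Measure.dirac θ) = fun w : S => neuron b σ (w : EuclideanSpace ℝ (Fin d)) θ := by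
  ext w
  simp [net]

lemma isP2_dirac (θ : Param d) : IsP2 (Measure.dirac θ) :=
  ⟨Measure.dirac.isProbabilityMeasure, by simp⟩

/-- Flipping the sign of the output weight preserves the Gaussian measure and, `b` being odd,
negates the neuron. -/
lemma integral_neuron_stdGaussian (hb : Function.Odd b) (w : EuclideanSpace ℝ (Fin d)) :
    ∫ θ, neuron b σ w θ ∂(stdGaussian (Param d)) = 0 := by
  let f : Param d ≃ₗᵢ[ℝ] Param d := LinearIsometryEquiv.piLpCongrRight 2
    fun i : Fin (d + 2) => if i = 0 then LinearIsometryEquiv.neg ℝ else LinearIsometryEquiv.refl ℝ ℝ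
  have hf : ∀ θ i, f θ i = if i = 0 then -θ i else θ i := fun θ i => by
    by_cases hi : i = 0 <;> simp [f, hi, LinearIsometryEquiv.piLpCongrRight_apply]
  have hneg : ∀ θ, neuron b σ w (f θ) = -neuron b σ w θ := fun θ => by
    have : preact w (f θ) = preact w θ := by
      simp [preact, hf, Fin.last_eq_zero_iff]
    rw [neuron_eq, neuron_eq, this, hf, if_pos rfl, hb]
    ring
  have hmp : MeasurePreserving f (stdGaussian (Param d)) (stdGaussian (Param d)) :=
    ⟨f.continuous.measurable, stdGaussian_map f⟩
  have h := hmp.integral_comp f.toHomeomorph.measurableEmbedding (neuron b σ w)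
  simp only [hneg, integral_neg] at h
  linarith

/-- The Gaussian component contributes nothing, and the weight `α⁻¹` of `μ` cancels the scale `α`.
-/
lemma net_mixture (hS : NeuronRegular b σ B₀ B₁ B₂ S)
    (hb : Function.Odd b) {α : ℝ} (hα : 1 ≤ α) (μ : Measure (Param d)) [IsProbabilityMeasure μ] :
    net b σ S α (mixture α μ) = net b σ S 1 μ := by
  ext w
  unfold net mixture
  have h1 := integrable_neuron hS (stdGaussian (Param d)) w
  have h2 := integrable_neuron hS μ w
  rw [integral_add_measure (h1.smul_measure (by simp)) (h2.smul_measure (by simp)),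
    integral_smul_measure, integral_smul_measure, integral_neuron_stdGaussian hb,
    ENNReal.toReal_ofReal (inv_nonneg.2 (zero_le_one.trans hα))]
  have hα0 : α ≠ 0 := by linarith
  rw [smul_zero, zero_add, smul_eq_mul, mul_inv_cancel_left₀ hα0, one_mul]

end Net

/-! ### Averages of signed kernels as differences of two measures. -/

lemma integral_bind_kernel {T W : Type*} [MeasurableSpace T] [MeasurableSpace W] {μ : Measure T}
    {κ : Kernel T W} {h : W → ℝ} (hh : Integrable h (μ.bind κ)) :
    Integrable (fun t => ∫ w, h w ∂(κ t)) μ ∧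
      ∫ w, h w ∂(μ.bind κ) = ∫ t, ∫ w, h w ∂(κ t) ∂μ := by
  rw [Measure.comp_eq_comp_const_apply] at hh
  have h1 := hh.integral_comp
  have h2 := Kernel.integral_comp hh
  rw [← Measure.comp_eq_comp_const_apply] at h2
  simp only [Kernel.const_apply] at h1 h2
  exact ⟨h1, h2⟩

namespace SignedKernel

variable {T W : Type*} [MeasurableSpace T] [MeasurableSpace W] (κ : SignedKernel T W)

instance : IsSFiniteKernel κ.pos := κ.sfinite_pos
instance : IsSFiniteKernel κ.neg := κ.sfinite_neg
instance (t : T) : IsFiniteMeasure (κ.pos t) := κ.finite_pos t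
instance (t : T) : IsFiniteMeasure (κ.neg t) := κ.finite_neg t

lemma measurable_pair {h : W → ℝ} (hh : Measurable h) : Measurable fun t => κ.pair t h :=
  hh.stronglyMeasurable.integral_kernel.measurable.sub
    hh.stronglyMeasurable.integral_kernel.measurable

lemma enorm_pair_le (t : T) (h : W → ℝ) : ‖κ.pair t h‖ₑ ≤ κ.absPair t h :=
  enorm_sub_le.trans (add_le_add (enorm_integral_le_lintegral_enorm _)
    (enorm_integral_le_lintegral_enorm _))

lemma absPair_le_of_bounded {h : W → ℝ} {C : ℝ} (hC : ∀ w, |h w| ≤ C) (t : T) :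
    κ.absPair t h ≤ ENNReal.ofReal C * κ.absPair t 1 := by
  have hle : ∀ w, ‖h w‖ₑ ≤ ENNReal.ofReal C * ‖(1 : W → ℝ) w‖ₑ := fun w => by
    rw [← ofReal_norm, Real.norm_eq_abs]
    simpa using ENNReal.ofReal_le_ofReal (hC w)
  unfold absPair
  rw [mul_add]
  refine add_le_add ?_ ?_ <;>
  · rw [← lintegral_const_mul' _ _ (by simp)]
    exact lintegral_mono hle

/-- The positive part of the mixture of the signed measures `κ t` with weights `u t D(dt)`; the
negative part is `κ.mix D (-u)`. -/
noncomputable def mix (D : Measure T) (u : T → ℝ) : Measure W :=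
  (D.withDensity fun t => ENNReal.ofReal (u t)).bind κ.pos
    + (D.withDensity fun t => ENNReal.ofReal (-u t)).bind κ.neg

variable {κ} {D : Measure T} {u : T → ℝ} {h : W → ℝ}

lemma lintegral_bind_withDensity_le {η : Kernel T W} {v : T → ℝ≥0∞} (hv : Measurable v)
    (hh : Measurable h) {r : T → ℝ≥0∞} (hr : ∀ t, ∫⁻ w, ‖h w‖ₑ ∂(η t) ≤ r t)
    (hvu : ∀ t, v t ≤ ‖u t‖ₑ) :
    ∫⁻ w, ‖h w‖ₑ ∂((D.withDensity v).bind η) ≤ ∫⁻ t, ‖u t‖ₑ * r t ∂D := by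
  rw [Measure.lintegral_bind (Kernel.aemeasurable _) hh.enorm.aemeasurable,
    lintegral_withDensity_eq_lintegral_mul _ hv hh.enorm.lintegral_kernel]
  exact lintegral_mono fun t => mul_le_mul' (hvu t) (hr t)

lemma integral_bind_withDensity {η : Kernel T W} (hu : Measurable u)
    (hi : Integrable h ((D.withDensity fun t => ENNReal.ofReal (u t)).bind η)) :
    Integrable (fun t => max (u t) 0 * ∫ w, h w ∂(η t)) D ∧
      ∫ w, h w ∂((D.withDensity fun t => ENNReal.ofReal (u t)).bind η)
        = ∫ t, max (u t) 0 * ∫ w, h w ∂(η t) ∂D := by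
  obtain ⟨h1, h2⟩ := integral_bind_kernel hi
  have hlt : ∀ᵐ t ∂D, ENNReal.ofReal (u t) < ∞ := ae_of_all _ fun t => ENNReal.ofReal_lt_top
  rw [integrable_withDensity_iff_integrable_smul' hu.ennreal_ofReal hlt] at h1
  rw [integral_withDensity_eq_integral_toReal_smul hu.ennreal_ofReal hlt] at h2
  simp only [ENNReal.toReal_ofReal', smul_eq_mul] at h1 h2
  exact ⟨h1, h2⟩

lemma ofReal_le_enorm_real (x : ℝ) : ENNReal.ofReal x ≤ ‖x‖ₑ := by
  rw [← ofReal_norm]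
  exact ENNReal.ofReal_le_ofReal (le_abs_self x)

lemma integrable_mix (hu : Measurable u) (hh : Measurable h)
    (hfin : ∫⁻ t, ‖u t‖ₑ * κ.absPair t h ∂D < ∞) : Integrable h (κ.mix D u) := by
  refine Integrable.add_measure ⟨hh.aestronglyMeasurable, ?_⟩ ⟨hh.aestronglyMeasurable, ?_⟩
  · exact (lintegral_bind_withDensity_le hu.ennreal_ofReal hh (fun t => le_self_add)
      fun t => ofReal_le_enorm_real _).trans_lt hfin
  · refine (lintegral_bind_withDensity_le hu.neg.ennreal_ofReal hh (fun t => le_add_self)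
      fun t => ?_).trans_lt hfin
    rw [← enorm_neg]
    exact ofReal_le_enorm_real _

/-- The integral of the pairings `κ t` with `h` as a difference of integrals over two measures. -/
lemma integral_mul_pair (hu : Measurable u) (hh : Measurable h)
    (hfin : ∫⁻ t, ‖u t‖ₑ * κ.absPair t h ∂D < ∞) :
    Integrable (fun t => u t * κ.pair t h) D ∧
      ∫ t, u t * κ.pair t h ∂D
        = ∫ w, h w ∂(κ.mix D u) - ∫ w, h w ∂(κ.mix D (-u)) := by
  have hi := integrable_mix hu hh hfin
  have hi' : Integrable h (κ.mix D (-u)) := integrable_mix hu.neg hh (by simpa using hfin)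
  unfold mix at hi hi'
  simp only [Pi.neg_apply, neg_neg] at hi'
  obtain ⟨a1, a2⟩ := integral_bind_withDensity hu hi.left_of_add_measure
  obtain ⟨b1, b2⟩ := integral_bind_withDensity hu.neg hi.right_of_add_measure
  obtain ⟨c1, c2⟩ := integral_bind_withDensity hu.neg hi'.left_of_add_measure
  obtain ⟨d1, d2⟩ := integral_bind_withDensity hu hi'.right_of_add_measure
  simp only [Pi.neg_apply] at b1 b2 c1 c2
  -- Both the weight and the kernel are split into positive and negative parts; the four products
  -- are grouped by sign.
  have key : (fun t => u t * κ.pair t h) = fun t =>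
      (max (u t) 0 * ∫ w, h w ∂(κ.pos t) + max (-u t) 0 * ∫ w, h w ∂(κ.neg t))
      - (max (-u t) 0 * ∫ w, h w ∂(κ.pos t) + max (u t) 0 * ∫ w, h w ∂(κ.neg t)) := by
    ext t
    unfold pair
    rcases le_total (u t) 0 with h0 | h0
    · rw [max_eq_right h0, max_eq_left (neg_nonneg.2 h0)]
      ring
    · rw [max_eq_left h0, max_eq_right (neg_nonpos.2 h0)]
      ring
  rw [key]
  refine ⟨(a1.add b1).sub (c1.add d1), ?_⟩
  refine (integral_sub (a1.add b1) (c1.add d1)).trans ?_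
  rw [integral_add' a1 b1, integral_add' c1 d1]
  unfold mix
  simp only [Pi.neg_apply, neg_neg]
  rw [integral_add_measure hi.left_of_add_measure hi.right_of_add_measure,
    integral_add_measure hi'.left_of_add_measure hi'.right_of_add_measure, a2, b2, c2, d2]

lemma isFiniteMeasure_mix (hu : Measurable u) (hfin : ∫⁻ t, ‖u t‖ₑ * κ.absPair t 1 ∂D < ∞) :
    IsFiniteMeasure (κ.mix D u) := by
  have := integrable_mix (h := 1) hu measurable_one hfin
  exact (integrable_const_iff_isFiniteMeasure one_ne_zero).1 this

/-- The kernel that evaluates test functions at a measurable map. -/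
noncomputable def eval {φ : T → W} (hφ : Measurable φ) : SignedKernel T W where
  pos := Kernel.deterministic φ hφ
  neg := 0
  sfinite_pos := inferInstance
  sfinite_neg := inferInstance
  finite_pos := fun t => by infer_instance
  finite_neg := fun t => by infer_instance

lemma eval_pair {φ : T → W} (hφ : Measurable φ) (t : T) (hh : Measurable h) :
    (eval hφ).pair t h = h (φ t) := by
  simp [pair, eval, Kernel.deterministic_apply, integral_dirac' _ _ hh.stronglyMeasurable]

lemma eval_absPair {φ : T → W} (hφ : Measurable φ) (t : T) (hh : Measurable h) :
    (eval hφ).absPair t h = ‖h (φ t)‖ₑ := by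
  simp [absPair, eval, Kernel.deterministic_apply, lintegral_dirac' _ hh.enorm]

end SignedKernel

/-- A random variable that is orthogonal to all ridge functions of `Z` is orthogonal to all
functions of `Z`. -/
lemma integral_mul_eq_zero_of_ridge {T : Type*} [MeasurableSpace T] {D : Measure T} {q : ℕ}
    {K : Set (EuclideanSpace ℝ (Fin q))} (hK : Bornology.IsBounded K) {σ b : ℝ → ℝ}
    (hp : ProfileRegular b σ) {Z : T → K} (hZ : Measurable Z) {r : T → ℝ} (hr : Integrable r D)
    (h0 : ∀ (w : EuclideanSpace ℝ (Fin q)) (c : ℝ),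
      ∫ t, r t * σ (inner ℝ w (Z t : EuclideanSpace ℝ (Fin q)) + c) ∂D = 0)
    {g : K → ℝ} (hg : Measurable g) (hrg : Integrable (fun t => r t * g (Z t)) D) :
    ∫ t, r t * g (Z t) ∂D = 0 := by
  -- `mix` is handled with measurable weights, so `r` is replaced by a measurable version.
  set u := hr.1.mk r with hu
  have hum : Measurable u := hr.1.stronglyMeasurable_mk.measurable
  have hae : r =ᵐ[D] u := hr.1.ae_eq_mk
  have hui : Integrable u D := hr.congr hae
  have key : ∀ k : K → ℝ, Measurable k → Integrable (fun t => r t * k (Z t)) D →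
      Integrable k ((SignedKernel.eval hZ).mix D u) ∧
      ∫ t, r t * k (Z t) ∂D = ∫ z, k z ∂((SignedKernel.eval hZ).mix D u)
        - ∫ z, k z ∂((SignedKernel.eval hZ).mix D (-u)) := by
    intro k hk hi
    have hfin : ∫⁻ t, ‖u t‖ₑ * (SignedKernel.eval hZ).absPair t k ∂D < ∞ := by
      have h1 := (hi.congr (hae.mono fun t ht => by simp only [ht] :
        (fun t => r t * k (Z t)) =ᵐ[D] fun t => u t * k (Z t))).2
      simpa only [HasFiniteIntegral, enorm_mul, SignedKernel.eval_absPair hZ _ hk] using h1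
    refine ⟨SignedKernel.integrable_mix hum hk hfin, ?_⟩
    rw [← (SignedKernel.integral_mul_pair hum hk hfin).2]
    simp only [SignedKernel.eval_pair hZ _ hk]
    exact integral_congr_ae (hae.mono fun t ht => by simp only [ht])
  have hfin1 : ∫⁻ t, ‖u t‖ₑ * (SignedKernel.eval hZ).absPair t 1 ∂D < ∞ := by
    simpa only [HasFiniteIntegral, SignedKernel.eval_absPair hZ _ measurable_one, Pi.one_apply,
      enorm_one, mul_one] using hui.2
  have := SignedKernel.isFiniteMeasure_mix hum hfin1
  have : IsFiniteMeasure ((SignedKernel.eval hZ).mix D (-u)) :=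
    SignedKernel.isFiniteMeasure_mix hum.neg (by simpa using hfin1)
  obtain ⟨C, hC⟩ := hp.bounded
  obtain ⟨x, y, hxy⟩ := hp.nonconstant
  have hσ := hp.differentiable_activation.continuous
  -- The two measures are the images under `Z` of the positive and negative parts of `u D`.
  have heq := ext_of_ridge hK hσ hC hxy (m₁ := (SignedKernel.eval hZ).mix D u)
    (m₂ := (SignedKernel.eval hZ).mix D (-u)) fun w c => by
      have hk : Measurable fun z : K => σ (inner ℝ w (z : EuclideanSpace ℝ (Fin q)) + c) :=
        Continuous.measurable (by fun_prop)
      have := (key _ hk (hr.mul_bdd (hk.comp hZ).aestronglyMeasurable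
        (ae_of_all _ fun t => hC _))).2
      rw [h0] at this
      linarith
  rw [(key g hg hrg).2, ← heq, sub_self]

/-! ### Quadratic expansions and first-order conditions. -/

namespace Model

variable {X : Type*} [MeasurableSpace X] {q d : ℕ}
  {Zs : Set (EuclideanSpace ℝ (Fin q))} {Ws : Set (EuclideanSpace ℝ (Fin d))}
  {M : Model X Zs Ws}

lemma IsAdmissible.Φ_add_smul (hM : M.IsAdmissible) (t : X × Zs) {f h : Ws → ℝ} (hf : f ∈ M.F)
    (hh : h ∈ M.F) (ε : ℝ) :
    M.Φ t (f + ε • h) = M.Φ t f + ε * (M.varΦ f).pair t h := by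
  have key : ∀ ε : ℝ, M.Φ t (f + ε • h) = M.Φ t f + ε * (M.Φ t h - M.Φ t 0) := fun ε => by
    have := hM.affine t f hf h hh 1 ε
    rw [one_smul] at this
    linarith
  have h1 := ((hM.varΦ_spec t f hf) h hh).2
  simp only [key] at h1
  have h2 : HasDerivAt (fun ε : ℝ => M.Φ t f + ε * (M.Φ t h - M.Φ t 0)) (M.Φ t h - M.Φ t 0) 0 := by
    simpa using ((hasDerivAt_id (0 : ℝ)).mul_const (M.Φ t h - M.Φ t 0)).const_add (M.Φ t f)
  rw [key, h1.unique h2]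

/-- Linearity of the variation makes the derivative along the line affine in `ε`, so `Ψ` is
quadratic there. The second-order coefficient is `Ψ t h` since at `0` both `Ψ` and its variation
vanish. -/
lemma IsAdmissible.Ψ_add_smul (hM : M.IsAdmissible) (t : X × Zs) {f h : Ws → ℝ} (hf : f ∈ M.F)
    (hh : h ∈ M.F) (ε : ℝ) :
    M.Ψ t (f + ε • h) = M.Ψ t f + ε * (M.varΨ f).pair t h + ε ^ 2 * M.Ψ t h := by
  have main : ∀ f ∈ M.F, ∀ ε : ℝ, M.Ψ t (f + ε • h)
      = M.Ψ t f + ε * (M.varΨ f).pair t h + ε ^ 2 / 2 * (M.varΨ h).pair t h := by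
    intro f hf ε
    have hd : ∀ s : ℝ, HasDerivAt (fun ε : ℝ => M.Ψ t (f + ε • h))
        ((M.varΨ f).pair t h + s * (M.varΨ h).pair t h) s := by
      intro s
      have h1 := ((hM.varΨ_spec t (f + s • h) (M.F.add_mem hf (M.F.smul_mem s hh))) h hh).2
      have h2 := hM.varΨ_linear t f hf h hh 1 s h hh
      rw [one_smul, one_mul] at h2
      rw [h2] at h1
      have h3 : HasDerivAt (fun ε : ℝ => ε - s) 1 s := by simpa using (hasDerivAt_id s).sub_const s
      have h4 := HasDerivAt.comp s (by simpa using h1) h3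
      rw [mul_one] at h4
      refine h4.congr_of_eventuallyEq (Eventually.of_forall fun ε => ?_)
      simp only [Function.comp_apply]
      rw [add_assoc, ← add_smul, add_sub_cancel]
    have hd2 : ∀ s : ℝ, HasDerivAt (fun ε : ℝ => M.Ψ t (f + ε • h)
        - (ε * (M.varΨ f).pair t h + ε ^ 2 / 2 * (M.varΨ h).pair t h)) 0 s := by
      intro s
      have h1 : HasDerivAt (fun ε : ℝ => ε * (M.varΨ f).pair t h
          + ε ^ 2 / 2 * (M.varΨ h).pair t h)
          ((M.varΨ f).pair t h + s * (M.varΨ h).pair t h) s := by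
        refine (((hasDerivAt_id s).mul_const _).add
          ((((hasDerivAt_id s).pow 2).div_const 2).mul_const _)).congr_deriv ?_
        simp
      exact ((hd s).sub h1).congr_deriv (sub_self _)
    have h5 := is_const_of_deriv_eq_zero (fun s => (hd2 s).differentiableAt)
      (fun s => (hd2 s).deriv) ε 0
    simp only [zero_smul, add_zero, zero_mul, ne_eq, OfNat.ofNat_ne_zero, not_false_eq_true,
      zero_pow, zero_div, sub_zero] at h5
    linarith
  have h0 : M.Ψ t h = 1 / 2 * (M.varΨ h).pair t h := by
    have h1 := main 0 M.F.zero_mem 1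
    have h2 := hM.varΨ_linear t 0 M.F.zero_mem 0 M.F.zero_mem 0 0 h hh
    simp only [smul_zero, add_zero, zero_mul] at h2
    rw [zero_add, one_smul, hM.Ψ_zero, h2] at h1
    rw [h1]
    ring
  rw [main f hf, h0]
  ring

/-- Test functions against which the mixtures of the variations at `f` can be integrated. -/
structure IsTest (M : Model X Zs Ws) (f h : Ws → ℝ) : Prop where
  measurable : Measurable h
  lintegralΦ : ∫⁻ t, (M.varΦ f).absPair t h ^ 2 ∂M.D < ∞
  lintegralΨ : ∫⁻ t, (M.varΨ f).absPair t h ∂M.D < ∞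

lemma IsAdmissible.isTest (hM : M.IsAdmissible) {f h : Ws → ℝ} (hf : f ∈ M.F) (hh : h ∈ M.F) :
    M.IsTest f h :=
  ⟨hM.measurable h hh, hM.integrableΦ f hf h hh, hM.integrableΨ f hf h hh⟩

/-- Intended for components of neuron gradients, which are bounded but need not lie in `M.F`. -/
lemma IsAdmissible.isTest_of_bounded (hM : M.IsAdmissible) {f h : Ws → ℝ} (hf : f ∈ M.F)
    (hh : Measurable h) {C : ℝ} (hC : ∀ w, |h w| ≤ C) : M.IsTest f h := by
  refine ⟨hh, ?_, ?_⟩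
  · calc _ ≤ ∫⁻ t, ENNReal.ofReal C ^ 2 * (M.varΦ f).absPair t 1 ^ 2 ∂M.D := by
          refine lintegral_mono fun t => ?_
          rw [← mul_pow]
          gcongr
          exact (M.varΦ f).absPair_le_of_bounded hC t
      _ < ∞ := by
          rw [lintegral_const_mul' _ _ (by simp)]
          exact ENNReal.mul_lt_top (by simp) (hM.massΦ f hf)
  · calc _ ≤ ∫⁻ t, ENNReal.ofReal C * (M.varΨ f).absPair t 1 ∂M.D :=
          lintegral_mono fun t => (M.varΨ f).absPair_le_of_bounded hC t
      _ < ∞ := by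
          rw [lintegral_const_mul' _ _ (by simp)]
          exact ENNReal.mul_lt_top (by simp) (hM.massΨ f hf)

/-- The derivative of the objective in the direction `h` of the primal variable. -/
noncomputable def pairing (M : Model X Zs Ws) (f : Ws → ℝ) (g : Zs → ℝ) (h : Ws → ℝ) : ℝ :=
  ∫ t, (g t.2 * (M.varΦ f).pair t h + M.lam * (M.varΨ f).pair t h) ∂M.D

/-- The positive part of the measure that represents `pairing`. -/
noncomputable def posMeasure (M : Model X Zs Ws) (f : Ws → ℝ) (g : Zs → ℝ) : Measure Ws :=
  (M.varΦ f).mix M.D (fun t => g t.2) + (M.varΨ f).mix M.D (fun _ => M.lam)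

/-- The negative part of the measure that represents `pairing`. -/
noncomputable def negMeasure (M : Model X Zs Ws) (f : Ws → ℝ) (g : Zs → ℝ) : Measure Ws :=
  (M.varΦ f).mix M.D (-fun t => g t.2) + (M.varΨ f).mix M.D (-fun _ => M.lam)

section Pairing

variable {f h : Ws → ℝ} {g : Zs → ℝ} {A : ℝ}

lemma IsTest.lintegral_mul_lt_top (hM : M.IsAdmissible) (hh : M.IsTest f h)
    (hA : ∀ z, |g z| ≤ A) :
    ∫⁻ t, ‖g t.2‖ₑ * (M.varΦ f).absPair t h ∂M.D < ∞ ∧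
      ∫⁻ t, ‖M.lam‖ₑ * (M.varΨ f).absPair t h ∂M.D < ∞ := by
  have := hM.prob
  constructor
  · calc _ ≤ ∫⁻ t, ENNReal.ofReal A * (1 + (M.varΦ f).absPair t h ^ 2) ∂M.D := by
          refine lintegral_mono fun t => mul_le_mul' ?_ ?_
          · rw [← ofReal_norm]
            exact ENNReal.ofReal_le_ofReal (hA _)
          · rcases le_total ((M.varΦ f).absPair t h) 1 with h1 | h1
            · exact h1.trans le_self_add
            · refine le_trans ?_ le_add_self
              rw [sq]
              exact le_mul_of_one_le_left' h1
      _ < ∞ := by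
          rw [lintegral_const_mul' _ _ (by simp), lintegral_add_left measurable_const]
          refine ENNReal.mul_lt_top (by simp) (ENNReal.add_lt_top.2 ⟨by simp, hh.lintegralΦ⟩)
  · rw [lintegral_const_mul' _ _ (by simp)]
    exact ENNReal.mul_lt_top (by simp) hh.lintegralΨ

lemma IsTest.integrable (hM : M.IsAdmissible) (hh : M.IsTest f h) (hg : Measurable g)
    (hA : ∀ z, |g z| ≤ A) :
    Integrable h (M.posMeasure f g) ∧ Integrable h (M.negMeasure f g) := by
  obtain ⟨h1, h2⟩ := hh.lintegral_mul_lt_top hM hA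
  have hgm : Measurable fun t : X × Zs => g t.2 := hg.comp measurable_snd
  exact ⟨(SignedKernel.integrable_mix hgm hh.measurable h1).add_measure
      (SignedKernel.integrable_mix measurable_const hh.measurable h2),
    (SignedKernel.integrable_mix hgm.neg hh.measurable (by simpa using h1)).add_measure
      (SignedKernel.integrable_mix measurable_const.neg hh.measurable (by simpa using h2))⟩

lemma IsTest.integrable_pair (hM : M.IsAdmissible) (hh : M.IsTest f h) (hg : Measurable g)
    (hA : ∀ z, |g z| ≤ A) :
    Integrable (fun t => g t.2 * (M.varΦ f).pair t h) M.D ∧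
      Integrable (fun t => M.lam * (M.varΨ f).pair t h) M.D := by
  obtain ⟨h1, h2⟩ := hh.lintegral_mul_lt_top hM hA
  have hgm : Measurable fun t : X × Zs => g t.2 := hg.comp measurable_snd
  exact ⟨(SignedKernel.integral_mul_pair hgm hh.measurable h1).1,
    (SignedKernel.integral_mul_pair (D := M.D) (u := fun _ => M.lam) measurable_const
      hh.measurable h2).1⟩

lemma IsTest.pairing_eq (hM : M.IsAdmissible) (hh : M.IsTest f h) (hg : Measurable g)
    (hA : ∀ z, |g z| ≤ A) :
    M.pairing f g h = ∫ w, h w ∂(M.posMeasure f g) - ∫ w, h w ∂(M.negMeasure f g) := by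
  obtain ⟨h1, h2⟩ := hh.lintegral_mul_lt_top hM hA
  have hgm : Measurable fun t : X × Zs => g t.2 := hg.comp measurable_snd
  obtain ⟨a1, a2⟩ := SignedKernel.integral_mul_pair hgm hh.measurable h1
  obtain ⟨b1, b2⟩ := SignedKernel.integral_mul_pair (D := M.D) (u := fun _ => M.lam)
    measurable_const hh.measurable h2
  obtain ⟨i1, i2⟩ := hh.integrable hM hg hA
  unfold posMeasure at i1 ⊢
  unfold negMeasure at i2 ⊢
  rw [pairing, integral_add a1 b1, a2, b2,
    integral_add_measure i1.left_of_add_measure i1.right_of_add_measure,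
    integral_add_measure i2.left_of_add_measure i2.right_of_add_measure]
  ring

lemma IsAdmissible.isFiniteMeasure (hM : M.IsAdmissible) (hf : f ∈ M.F) (hg : Measurable g)
    (hA : ∀ z, |g z| ≤ A) :
    IsFiniteMeasure (M.posMeasure f g) ∧ IsFiniteMeasure (M.negMeasure f g) := by
  have h1 := (hM.isTest_of_bounded hf (h := fun _ => (1 : ℝ)) measurable_const (C := 1)
    (by simp)).integrable hM hg hA
  exact ⟨(integrable_const_iff_isFiniteMeasure one_ne_zero).1 h1.1,
    (integrable_const_iff_isFiniteMeasure one_ne_zero).1 h1.2⟩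

end Pairing

lemma IsAdmissible.memLp_Φ (hM : M.IsAdmissible) {f : Ws → ℝ} (hf : f ∈ M.F) :
    MemLp (fun t => M.Φ t f) 2 M.D := by
  have h : (fun t => M.Φ t f) = (fun t => M.Φ t 0) + fun t => (M.varΦ 0).pair t f := by
    ext t
    have := hM.Φ_add_smul t M.F.zero_mem hf 1
    simpa using this
  rw [h]
  refine hM.zero_memLp.add ⟨((M.varΦ 0).measurable_pair (hM.measurable f hf)).aestronglyMeasurable,
    ?_⟩
  rw [eLpNorm_lt_top_iff_lintegral_rpow_enorm_lt_top (by simp) (by simp)]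
  refine lt_of_le_of_lt (lintegral_mono fun t => ?_) (hM.integrableΦ 0 M.F.zero_mem f hf)
  simp only [ENNReal.toReal_ofNat, ENNReal.rpow_ofNat]
  gcongr
  exact (M.varΦ 0).enorm_pair_le t f

lemma IsAdmissible.integrable_Ψ (hM : M.IsAdmissible) {f : Ws → ℝ} (hf : f ∈ M.F) :
    Integrable (fun t => M.Ψ t f) M.D := by
  have h : ∀ t, M.Ψ t f = 1 / 2 * (M.varΨ f).pair t f := fun t => by
    -- Moving from `f` by `-f` reaches `0`, which expresses `Ψ t f` as half the pairing of its
    -- variation with `f`.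
    have h1 := hM.Ψ_add_smul t hf hf (-1)
    rw [neg_one_smul, add_neg_cancel, hM.Ψ_zero] at h1
    linarith
  simp only [h]
  refine Integrable.const_mul
    ⟨((M.varΨ f).measurable_pair (hM.measurable f hf)).aestronglyMeasurable, ?_⟩ _
  exact lt_of_le_of_lt (lintegral_mono fun t => (M.varΨ f).enorm_pair_le t f)
    (hM.integrableΨ f hf f hf)

lemma mem_dualClass_of_bounded (hM : M.IsAdmissible) {g : Zs → ℝ} (hg : Measurable g) {A : ℝ}
    (hA : ∀ z, |g z| ≤ A) : g ∈ M.dualClass := by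
  have := hM.prob
  exact ⟨hg, MemLp.of_bound (hg.comp measurable_snd).aestronglyMeasurable A
    (ae_of_all _ fun t => hA _)⟩

lemma add_smul_mem_dualClass {g u : Zs → ℝ} (hg : g ∈ M.dualClass) (hu : u ∈ M.dualClass) (ε : ℝ) :
    g + ε • u ∈ M.dualClass :=
  ⟨hg.1.add (hu.1.const_smul ε), hg.2.add (hu.2.const_smul ε)⟩

lemma IsAdmissible.integrable_objective (hM : M.IsAdmissible) {f : Ws → ℝ} (hf : f ∈ M.F)
    {g : Zs → ℝ} (hg : g ∈ M.dualClass) :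
    Integrable (fun t : X × Zs => g t.2 * M.Φ t f - 1 / 2 * g t.2 ^ 2 + M.lam * M.Ψ t f) M.D :=
  ((hg.2.integrable_mul (hM.memLp_Φ hf)).sub (hg.2.integrable_sq.const_mul _)).add
    ((hM.integrable_Ψ hf).const_mul _)

/-- The expansion is exact, and its quadratic term is nonnegative; this turns a vanishing first
variation into global minimality. -/
lemma IsAdmissible.objective_add_smul_primal (hM : M.IsAdmissible) {f h : Ws → ℝ} (hf : f ∈ M.F)
    (hh : h ∈ M.F) {g : Zs → ℝ} (hg : Measurable g) {A : ℝ} (hA : ∀ z, |g z| ≤ A) (ε : ℝ) :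
    M.objective (f + ε • h) g = M.objective f g + ε * M.pairing f g h
      + ε ^ 2 * (M.lam * ∫ t, M.Ψ t h ∂M.D) := by
  have h0 := hM.integrable_objective hf (mem_dualClass_of_bounded hM hg hA)
  obtain ⟨h1, h2⟩ := (hM.isTest hf hh).integrable_pair hM hg hA
  have h3 := (hM.integrable_Ψ hh).const_mul M.lam
  have key : ∀ t : X × Zs, g t.2 * M.Φ t (f + ε • h) - 1 / 2 * g t.2 ^ 2
      + M.lam * M.Ψ t (f + ε • h) = (g t.2 * M.Φ t f - 1 / 2 * g t.2 ^ 2 + M.lam * M.Ψ t f)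
        + (ε * (g t.2 * (M.varΦ f).pair t h + M.lam * (M.varΨ f).pair t h)
          + ε ^ 2 * (M.lam * M.Ψ t h)) := fun t => by
    rw [hM.Φ_add_smul t hf hh, hM.Ψ_add_smul t hf hh]
    ring
  unfold objective pairing
  simp only [key]
  have h4 := (h1.add h2).const_mul ε
  simp only [Pi.add_apply] at h4
  have h5 : Integrable (fun t => ε * (g t.2 * (M.varΦ f).pair t h + M.lam * (M.varΨ f).pair t h)
      + ε ^ 2 * (M.lam * M.Ψ t h)) M.D := h4.add (h3.const_mul _)
  rw [integral_add h0 h5, integral_add h4 (h3.const_mul _),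
    integral_const_mul, integral_const_mul, integral_const_mul]
  ring

lemma IsAdmissible.objective_add_smul_dual (hM : M.IsAdmissible) {f : Ws → ℝ} (hf : f ∈ M.F)
    {g u : Zs → ℝ} (hg : g ∈ M.dualClass) (hu : u ∈ M.dualClass) (ε : ℝ) :
    M.objective f (g + ε • u) = M.objective f g + ε * ∫ t, (M.Φ t f - g t.2) * u t.2 ∂M.D
      - ε ^ 2 * (1 / 2 * ∫ t, u t.2 ^ 2 ∂M.D) := by
  have h0 := hM.integrable_objective hf hg
  have h1 : Integrable (fun t : X × Zs => (M.Φ t f - g t.2) * u t.2) M.D :=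
    ((hM.memLp_Φ hf).sub hg.2).integrable_mul hu.2
  have h2 : Integrable (fun t : X × Zs => 1 / 2 * u t.2 ^ 2) M.D := hu.2.integrable_sq.const_mul _
  have key : ∀ t : X × Zs, (g + ε • u) t.2 * M.Φ t f - 1 / 2 * (g + ε • u) t.2 ^ 2
      + M.lam * M.Ψ t f = (g t.2 * M.Φ t f - 1 / 2 * g t.2 ^ 2 + M.lam * M.Ψ t f)
        + (ε * ((M.Φ t f - g t.2) * u t.2) - ε ^ 2 * (1 / 2 * u t.2 ^ 2)) := fun t => by
    simp only [Pi.add_apply, Pi.smul_apply, smul_eq_mul]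
    ring
  unfold objective
  simp only [key]
  have h3 : Integrable (fun t : X × Zs => ε * ((M.Φ t f - g t.2) * u t.2)
      - ε ^ 2 * (1 / 2 * u t.2 ^ 2)) M.D := (h1.const_mul _).sub (h2.const_mul _)
  rw [integral_add h0 h3, integral_sub (h1.const_mul _) (h2.const_mul _),
    integral_const_mul, integral_const_mul, integral_const_mul]
  ring

/-- First-order conditions are sufficient for a saddle point. -/
lemma IsAdmissible.isSaddle (hM : M.IsAdmissible) {f : Ws → ℝ} (hf : f ∈ M.F) {g : Zs → ℝ}
    (hg : Measurable g) {A : ℝ} (hA : ∀ z, |g z| ≤ A) (hF : ∀ h ∈ M.F, M.pairing f g h = 0)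
    (hG : ∀ u ∈ M.dualClass, ∫ t, (M.Φ t f - g t.2) * u t.2 ∂M.D = 0) : M.IsSaddle f g := by
  have hgd := mem_dualClass_of_bounded hM hg hA
  refine ⟨hf, hgd, fun f' hf' g' hg' => ?_⟩
  have h1 : M.objective f g' ≤ M.objective f g := by
    have hu := add_smul_mem_dualClass hg' hgd (-1)
    have := hM.objective_add_smul_dual hf hgd hu 1
    rw [hG _ hu, show g + (1 : ℝ) • (g' + (-1 : ℝ) • g) = g' by
      rw [one_smul, neg_one_smul]; abel] at this
    have hnn : 0 ≤ ∫ t, (g' + (-1 : ℝ) • g) t.2 ^ 2 ∂M.D := integral_nonneg fun t => sq_nonneg _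
    linarith
  have h2 : M.objective f g ≤ M.objective f' g := by
    have hh := M.F.sub_mem hf' hf
    have := hM.objective_add_smul_primal hf hh hg hA 1
    rw [hF _ hh, one_smul, add_sub_cancel] at this
    have hnn : 0 ≤ M.lam * ∫ t, M.Ψ t (f' - f) ∂M.D :=
      mul_nonneg hM.lam_nonneg (integral_nonneg fun t => hM.Ψ_nonneg t _ hh)
    linarith
  exact h1.trans h2

lemma eq_zero_of_forall_quadratic {a c : ℝ} (h : ∀ ε : ℝ, 0 ≤ ε * a + ε ^ 2 * c) : a = 0 := by
  by_contra ha
  have hc : 0 < 1 + |c| := by positivity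
  -- A step against the sign of `a`, short enough that the linear term outweighs the quadratic one.
  have h1 := h (-(a / (1 + |c|)))
  have h2 : -(a / (1 + |c|)) * a + (-(a / (1 + |c|))) ^ 2 * c
      = -(a ^ 2 / (1 + |c|) ^ 2) * (1 + |c| - c) := by
    field_simp
    ring
  rw [h2] at h1
  have h3 : 0 < 1 + |c| - c := by linarith [le_abs_self c]
  have h4 : 0 < a ^ 2 / (1 + |c|) ^ 2 := by positivity
  nlinarith [mul_pos h4 h3]

/-- First-order conditions are necessary for a saddle point. -/
lemma IsAdmissible.pairing_eq_zero (hM : M.IsAdmissible) {f h : Ws → ℝ} {g : Zs → ℝ}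
    (hs : M.IsSaddle f g) {A : ℝ} (hA : ∀ z, |g z| ≤ A) (hh : h ∈ M.F) : M.pairing f g h = 0 := by
  obtain ⟨hf, hg, hs⟩ := hs
  refine eq_zero_of_forall_quadratic (c := M.lam * ∫ t, M.Ψ t h ∂M.D) fun ε => ?_
  have h1 := hs (f + ε • h) (M.F.add_mem hf (M.F.smul_mem ε hh)) g hg
  rw [hM.objective_add_smul_primal hf hh hg.1 hA] at h1
  linarith

lemma IsAdmissible.integral_residual_eq_zero (hM : M.IsAdmissible) {f : Ws → ℝ} {g u : Zs → ℝ}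
    (hs : M.IsSaddle f g) (hu : u ∈ M.dualClass) :
    ∫ t, (M.Φ t f - g t.2) * u t.2 ∂M.D = 0 := by
  obtain ⟨hf, hg, hs⟩ := hs
  rw [← neg_eq_zero]
  refine eq_zero_of_forall_quadratic (c := 1 / 2 * ∫ t, u t.2 ^ 2 ∂M.D) fun ε => ?_
  have h1 := hs f hf (g + ε • u) (add_smul_mem_dualClass hg hu ε)
  rw [hM.objective_add_smul_dual hf hg hu] at h1
  linarith

end Model

/-! ### Gradients of neurons, velocity fields and stationarity. -/

section Gradient

variable {b σ : ℝ → ℝ} {B₀ B₁ B₂ : ℝ} {d : ℕ} {S : Set (EuclideanSpace ℝ (Fin d))}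

lemma measurable_gradient_neuron_apply (hp : ProfileRegular b σ)
    (hS : NeuronRegular b σ B₀ B₁ B₂ S) (θ : Param d) (i : Fin (d + 2)) :
    Measurable fun w : S => gradient (neuron b σ (w : EuclideanSpace ℝ (Fin d))) θ i := by
  have h := (continuous_gradient_neuron hp hS θ (EuclideanSpace.single i (1 : ℝ))).measurable
  simpa only [EuclideanSpace.inner_single_right, one_mul, conj_trivial] using h

lemma abs_gradient_neuron_apply_le (hS : NeuronRegular b σ B₀ B₁ B₂ S) (θ : Param d)
    (i : Fin (d + 2)) (w : S) :
    |gradient (neuron b σ (w : EuclideanSpace ℝ (Fin d))) θ i| ≤ B₁ :=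
  (PiLp.norm_apply_le _ i).trans (hS.bound_gradient w w.2 θ)

/-- The output-weight component of the gradient is a multiple of a ridge function; this links
vanishing velocities to `ext_of_ridge`. -/
lemma gradient_neuron_mkParam_apply_zero (hp : ProfileRegular b σ)
    (hS : NeuronRegular b σ B₀ B₁ B₂ S) (β : ℝ) (v : EuclideanSpace ℝ (Fin d)) (c : ℝ) (w : S) :
    gradient (neuron b σ (w : EuclideanSpace ℝ (Fin d))) (mkParam β v c) 0
      = deriv b β * σ (⟪v, (w : EuclideanSpace ℝ (Fin d))⟫ + c) := by
  have h := inner_gradient_neuron_single_zero hp.differentiable_output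
    hp.differentiable_activation (hS.differentiable w w.2) (mkParam β v c)
  rwa [EuclideanSpace.inner_single_right, one_mul, mkParam_zero, preact_mkParam] at h

/-- Two measures that agree on all neurons agree on the gradients of the neurons. -/
lemma integral_gradient_neuron_eq (hp : ProfileRegular b σ) (hS : NeuronRegular b σ B₀ B₁ B₂ S)
    {m₁ m₂ : Measure S} [IsFiniteMeasure m₁] [IsFiniteMeasure m₂]
    (h : ∀ θ : Param d, ∫ w : S, neuron b σ (w : EuclideanSpace ℝ (Fin d)) θ ∂m₁
      = ∫ w : S, neuron b σ (w : EuclideanSpace ℝ (Fin d)) θ ∂m₂) (θ : Param d)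
    (i : Fin (d + 2)) :
    ∫ w : S, gradient (neuron b σ (w : EuclideanSpace ℝ (Fin d))) θ i ∂m₁
      = ∫ w : S, gradient (neuron b σ (w : EuclideanSpace ℝ (Fin d))) θ i ∂m₂ := by
  set e : Param d := EuclideanSpace.single i (1 : ℝ) with he
  have hmeas : ∀ θ : Param d, Measurable fun w : S => neuron b σ (w : EuclideanSpace ℝ (Fin d)) θ :=
    fun θ => (hp.continuous_neuron.comp (by fun_prop :
      Continuous fun w : S => ((w : EuclideanSpace ℝ (Fin d)), θ))).measurable
  -- The neuron identity is differentiated in the parameter along the `i`-th coordinate, with the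
  -- gradient bound as dominating constant.
  have key : ∀ (m : Measure S) [IsFiniteMeasure m],
      HasDerivAt (fun t : ℝ => ∫ w : S, neuron b σ (w : EuclideanSpace ℝ (Fin d)) (θ + t • e) ∂m)
        (∫ w : S, gradient (neuron b σ (w : EuclideanSpace ℝ (Fin d))) θ i ∂m) 0 := by
    intro m _
    have h1 := (hasDerivAt_integral_of_dominated_loc_of_deriv_le (μ := m) (x₀ := (0 : ℝ))
      (F := fun (t : ℝ) (w : S) => neuron b σ (w : EuclideanSpace ℝ (Fin d)) (θ + t • e))
      (F' := fun (t : ℝ) (w : S) =>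
        gradient (neuron b σ (w : EuclideanSpace ℝ (Fin d))) (θ + t • e) i)
      (bound := fun _ => B₁) (s := univ) univ_mem
      (Eventually.of_forall fun t => (hmeas _).aestronglyMeasurable)
      (integrable_of_bounded_of_measurable m (hmeas _) fun w => hS.bound w w.2 _)
      (measurable_gradient_neuron_apply hp hS _ i).aestronglyMeasurable
      (ae_of_all _ fun w t _ => abs_gradient_neuron_apply_le hS _ i w)
      (integrable_const _)
      (ae_of_all _ fun w t _ => by
        have := hasDerivAt_neuron_line (hS.differentiable w w.2) θ e t
        rwa [he, EuclideanSpace.inner_single_right, one_mul] at this)).2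
    simpa only [zero_smul, add_zero] using h1
  have h1 := key m₁
  simp only [h] at h1
  exact h1.unique (key m₂)

end Gradient

namespace Model

variable {X : Type*} [MeasurableSpace X] {q d : ℕ}
  {Zs : Set (EuclideanSpace ℝ (Fin q))} {Ws : Set (EuclideanSpace ℝ (Fin d))}
  {M : Model X Zs Ws} {b σ : ℝ → ℝ} {B₀ B₁ B₂ : ℝ}

lemma pair_apply {T : Type*} [MeasurableSpace T] (κ : SignedKernel T Ws) (t : T)
    {n : ℕ} {G : Ws → EuclideanSpace ℝ (Fin n)} (hG : ∀ i, Measurable fun w => G w i) {C : ℝ}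
    (hC : ∀ i w, |G w i| ≤ C) (i : Fin n) :
    κ.pair t G i = κ.pair t fun w => G w i := by
  unfold SignedKernel.pair
  rw [PiLp.sub_apply, eval_integral_piLp fun i =>
      integrable_of_bounded_of_measurable _ (hG i) (hC i),
    eval_integral_piLp fun i => integrable_of_bounded_of_measurable _ (hG i) (hC i)]

/-- Reduces the vector-valued velocity to scalar first variations of the objective. -/
lemma velF_apply (hM : M.IsAdmissible) (hp : ProfileRegular b σ)
    (hφ : NeuronRegular b σ B₀ B₁ B₂ Ws) (hψ : NeuronRegular b σ B₀ B₁ B₂ Zs) {α : ℝ}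
    {μ : Measure (Param d)} {ν : Measure (Param q)} [IsProbabilityMeasure ν]
    (hf : net b σ Ws α μ ∈ M.F) (θ : Param d) (i : Fin (d + 2)) :
    M.velF b σ α μ ν θ i = -(α * M.pairing (net b σ Ws α μ) (net b σ Zs α ν)
      fun w : Ws => gradient (neuron b σ (w : EuclideanSpace ℝ (Fin d))) θ i) := by
  have hGm := measurable_gradient_neuron_apply hp hφ θ
  have hGb := abs_gradient_neuron_apply_le hφ θ
  have hco : ∀ (t : X × Zs) (i : Fin (d + 2)),
      (-(net b σ Zs α ν t.2) • (M.varΦ (net b σ Ws α μ)).pair t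
          (fun w => gradient (neuron b σ (w : EuclideanSpace ℝ (Fin d))) θ)
        - M.lam • (M.varΨ (net b σ Ws α μ)).pair t
          (fun w => gradient (neuron b σ (w : EuclideanSpace ℝ (Fin d))) θ)) i
      = -(net b σ Zs α ν t.2 * (M.varΦ (net b σ Ws α μ)).pair t
          (fun w => gradient (neuron b σ (w : EuclideanSpace ℝ (Fin d))) θ i)
        + M.lam * (M.varΨ (net b σ Ws α μ)).pair t
          fun w => gradient (neuron b σ (w : EuclideanSpace ℝ (Fin d))) θ i) := fun t i => by
    rw [PiLp.sub_apply, PiLp.smul_apply, PiLp.smul_apply, pair_apply _ t hGm hGb,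
      pair_apply _ t hGm hGb, smul_eq_mul, smul_eq_mul]
    ring
  unfold velF pairing
  rw [PiLp.smul_apply, eval_integral_piLp, smul_eq_mul]
  · simp only [hco]
    rw [integral_neg, mul_neg]
  · intro i
    simp only [hco]
    obtain ⟨h1, h2⟩ := (hM.isTest_of_bounded hf (hGm i) (hGb i)).integrable_pair hM
      (measurable_net hp α ν) (abs_net_le hψ α ν)
    exact (h1.add h2).neg

lemma velG_apply (hM : M.IsAdmissible) (hp : ProfileRegular b σ)
    (hψ : NeuronRegular b σ B₀ B₁ B₂ Zs) {α : ℝ} {μ : Measure (Param d)} {ν : Measure (Param q)}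
    [IsProbabilityMeasure ν] (hf : net b σ Ws α μ ∈ M.F) (ω : Param q) (i : Fin (q + 2)) :
    M.velG b σ α μ ν ω i = α * ∫ t, (M.Φ t (net b σ Ws α μ) - net b σ Zs α ν t.2)
      * gradient (neuron b σ (t.2 : EuclideanSpace ℝ (Fin q))) ω i ∂M.D := by
  unfold velG
  rw [PiLp.smul_apply, eval_integral_piLp, smul_eq_mul]
  · simp only [PiLp.smul_apply, smul_eq_mul]
  · intro i
    simp only [PiLp.smul_apply, smul_eq_mul]
    have hg := mem_dualClass_of_bounded hM (measurable_net hp α ν) (abs_net_le hψ α ν)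
    have hu := mem_dualClass_of_bounded hM (measurable_gradient_neuron_apply hp hψ ω i)
      (abs_gradient_neuron_apply_le hψ ω i)
    exact ((hM.memLp_Φ hf).sub hg.2).integrable_mul hu.2

lemma IsAdmissible.nonempty (hM : M.IsAdmissible) : Zs.Nonempty := by
  have := hM.prob
  obtain ⟨t⟩ := nonempty_of_isProbabilityMeasure M.D
  exact ⟨t.2, t.2.2⟩

/-- Stationary points of the gradient flow give saddle points. -/
lemma isSaddle_of_isStationary (hZs : Bornology.IsBounded Zs) (hWs : Bornology.IsBounded Ws)
    (hM : M.IsAdmissible) (hp : ProfileRegular b σ)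
    (hφ : NeuronRegular b σ B₀ B₁ B₂ Ws) (hψ : NeuronRegular b σ B₀ B₁ B₂ Zs)
    {α : ℝ} (hα : 0 < α) {μ : Measure (Param d)} {ν : Measure (Param q)}
    (hf : net b σ Ws α μ ∈ M.F) (hst : M.IsStationary b σ α μ ν) :
    M.IsSaddle (net b σ Ws α μ) (net b σ Zs α ν) := by
  obtain ⟨-, _, hvF, hvG⟩ := hst
  have := hM.prob
  obtain ⟨β, hβ⟩ := hp.deriv_output_ne_zero
  obtain ⟨C, hC⟩ := hp.bounded
  have hσ := hp.differentiable_activation.continuous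
  have hgm := measurable_net (S := Zs) hp α ν
  have hgb := abs_net_le hψ α ν
  have hgd := mem_dualClass_of_bounded hM hgm hgb
  refine hM.isSaddle hf hgm hgb (fun h hh => ?_) fun u hu => ?_
  · obtain ⟨_, _⟩ := hM.isFiniteMeasure hf hgm hgb
    obtain ⟨x, y, hxy⟩ := hp.nonconstant
    suffices heq : M.posMeasure (net b σ Ws α μ) (net b σ Zs α ν)
        = M.negMeasure (net b σ Ws α μ) (net b σ Zs α ν) by
      rw [(hM.isTest hf hh).pairing_eq hM hgm hgb, heq, sub_self]
    refine ext_of_ridge hWs hσ hC hxy fun v c => ?_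
    have hk : Measurable fun w : Ws => σ (⟪v, (w : EuclideanSpace ℝ (Fin d))⟫ + c) :=
      Continuous.measurable (by fun_prop)
    -- Only the output-weight component is needed, at a fixed `β` with `b'(β) ≠ 0`; the factors `α`
    -- and `b'(β)` then cancel.
    have h1 := velF_apply hM hp hφ hψ (ν := ν) hf (mkParam β v c) 0
    rw [hvF, (hM.isTest_of_bounded hf (measurable_gradient_neuron_apply hp hφ _ _)
      (abs_gradient_neuron_apply_le hφ _ _)).pairing_eq hM hgm hgb] at h1
    simp only [gradient_neuron_mkParam_apply_zero hp hφ, integral_const_mul, PiLp.zero_apply] at h1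
    rw [eq_comm, neg_eq_zero, mul_eq_zero, ← mul_sub, mul_eq_zero] at h1
    exact sub_eq_zero.1 ((h1.resolve_left hα.ne').resolve_left hβ)
  · have hr : MemLp (fun t : X × Zs => M.Φ t (net b σ Ws α μ) - net b σ Zs α ν t.2) 2 M.D :=
      (hM.memLp_Φ hf).sub hgd.2
    refine integral_mul_eq_zero_of_ridge hZs hp measurable_snd (hr.integrable one_le_two) ?_ hu.1
      (hr.integrable_mul hu.2)
    intro v c
    have h1 := velG_apply hM hp hψ (ν := ν) hf (mkParam β v c) 0
    rw [hvG] at h1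
    simp only [gradient_neuron_mkParam_apply_zero hp hψ, mul_left_comm _ (deriv b β),
      integral_const_mul, PiLp.zero_apply] at h1
    rw [eq_comm, mul_eq_zero, mul_eq_zero] at h1
    exact (h1.resolve_left hβ).resolve_left hα.ne'

/-- Mean-field representations of saddle points are stationary. -/
lemma isStationary_of_isSaddle (hM : M.IsAdmissible) (hp : ProfileRegular b σ)
    (hφ : NeuronRegular b σ B₀ B₁ B₂ Ws) (hψ : NeuronRegular b σ B₀ B₁ B₂ Zs)
    (hF : ∀ θ : Param d, (fun w : Ws => neuron b σ (w : EuclideanSpace ℝ (Fin d)) θ) ∈ M.F)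
    {α : ℝ} {μ : Measure (Param d)} {ν : Measure (Param q)} [IsProbabilityMeasure μ]
    [IsProbabilityMeasure ν] (hs : M.IsSaddle (net b σ Ws α μ) (net b σ Zs α ν)) :
    M.IsStationary b σ α μ ν := by
  have hf := hs.1
  have hgm := measurable_net (S := Zs) hp α ν
  have hgb := abs_net_le hψ α ν
  refine ⟨inferInstance, inferInstance, fun θ => ?_, fun ω => ?_⟩
  · obtain ⟨_, _⟩ := hM.isFiniteMeasure hf hgm hgb
    ext i
    -- The first-order condition is available on `M.F`, which contains the neurons; it is passed to
    -- their gradients by differentiating under the two representing measures.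
    rw [velF_apply hM hp hφ hψ hf, (hM.isTest_of_bounded hf
      (measurable_gradient_neuron_apply hp hφ _ _)
      (abs_gradient_neuron_apply_le hφ _ _)).pairing_eq hM hgm hgb,
      integral_gradient_neuron_eq hp hφ
        (m₁ := M.posMeasure (net b σ Ws α μ) (net b σ Zs α ν))
        (m₂ := M.negMeasure (net b σ Ws α μ) (net b σ Zs α ν)) ?_,
      sub_self, mul_zero, neg_zero, PiLp.zero_apply]
    intro θ
    have h1 := hM.pairing_eq_zero hs hgb (hF θ)
    rw [(hM.isTest hf (hF θ)).pairing_eq hM hgm hgb] at h1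
    exact sub_eq_zero.1 h1
  · ext i
    rw [velG_apply hM hp hψ hf, PiLp.zero_apply]
    have hu := mem_dualClass_of_bounded hM (measurable_gradient_neuron_apply hp hψ ω i)
      (abs_gradient_neuron_apply_le hψ ω i)
    rw [hM.integral_residual_eq_zero hs hu, mul_zero]

end Model

end MeanFieldMinimax

/-! ### Assembly of the two statements. -/

theorem lemma4p4 {X : Type*} [MeasurableSpace X] {q d : ℕ}
    {Zs : Set (EuclideanSpace ℝ (Fin q))} {Ws : Set (EuclideanSpace ℝ (Fin d))}
    (hZs : Bornology.IsBounded Zs) (hWs : Bornology.IsBounded Ws)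
    (M : MeanFieldMinimax.Model X Zs Ws) (hM : M.IsAdmissible)
    (b σ : ℝ → ℝ) (B₀ B₁ B₂ : ℝ) (hB₀ : 0 < B₀) (hB₁ : 0 < B₁) (hB₂ : 0 < B₂)
    (hb : Function.Odd b) (hrange : Set.range b = Set.Ioo (-B₀) B₀)
    (hσ : ¬ ∃ P : Polynomial ℝ, ∀ s, σ s = P.eval s)
    (hφ : MeanFieldMinimax.NeuronRegular b σ B₀ B₁ B₂ Ws)
    (hψ : MeanFieldMinimax.NeuronRegular b σ B₀ B₁ B₂ Zs)
    (hF : ∀ μ : Measure (MeanFieldMinimax.Param d), MeanFieldMinimax.IsP2 μ →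
      MeanFieldMinimax.net b σ Ws 1 μ ∈ M.F) :
    -- (i) stationary points give saddle points
    (∀ α : ℝ, 0 < α → ∀ (μ : Measure (MeanFieldMinimax.Param d))
        (ν : Measure (MeanFieldMinimax.Param q)),
      MeanFieldMinimax.net b σ Ws α μ ∈ M.F → M.IsStationary b σ α μ ν →
        M.IsSaddle (MeanFieldMinimax.net b σ Ws α μ) (MeanFieldMinimax.net b σ Zs α ν)) ∧
    -- (ii) under realizability there are stationary points close to the Gaussian initialization
    (∀ (fs : Ws → ℝ) (gs : Zs → ℝ) (μd : Measure (MeanFieldMinimax.Param d))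
        (νd : Measure (MeanFieldMinimax.Param q)),
      M.IsSaddle fs gs → MeanFieldMinimax.IsP2 μd → MeanFieldMinimax.IsP2 νd →
      fs = MeanFieldMinimax.net b σ Ws 1 μd → gs = MeanFieldMinimax.net b σ Zs 1 νd →
      -- for each scale separately
      (∀ α : ℝ, 1 ≤ α → ∃ (μ : Measure (MeanFieldMinimax.Param d))
          (ν : Measure (MeanFieldMinimax.Param q)) (Dbar : ℝ), 0 < Dbar ∧
        M.IsStationary b σ α μ ν ∧
        MeanFieldMinimax.W2 (stdGaussian (MeanFieldMinimax.Param d)) μ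
          ≤ ENNReal.ofReal (α⁻¹ * Dbar) ∧
        MeanFieldMinimax.W2 (stdGaussian (MeanFieldMinimax.Param q)) ν
          ≤ ENNReal.ofReal (α⁻¹ * Dbar)) ∧
      -- with a constant that does not depend on the scale, for finite chi-square divergences
      (MeanFieldMinimax.chiSq μd (stdGaussian (MeanFieldMinimax.Param d)) < ∞ →
        MeanFieldMinimax.chiSq νd (stdGaussian (MeanFieldMinimax.Param q)) < ∞ →
        ∃ Dbar : ℝ, 0 < Dbar ∧ ∀ α : ℝ, 1 ≤ α →
          ∃ (μ : Measure (MeanFieldMinimax.Param d)) (ν : Measure (MeanFieldMinimax.Param q)),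
            M.IsStationary b σ α μ ν ∧
            MeanFieldMinimax.W2 (stdGaussian (MeanFieldMinimax.Param d)) μ
              ≤ ENNReal.ofReal (α⁻¹ * Dbar) ∧
            MeanFieldMinimax.W2 (stdGaussian (MeanFieldMinimax.Param q)) ν
              ≤ ENNReal.ofReal (α⁻¹ * Dbar))) := by
  have := hM.prob
  obtain ⟨z, hz⟩ := hM.nonempty
  -- The profile is read off on `Zs`, which is nonempty because it carries a probability measure;
  -- `Ws` could be empty.
  have hp := hψ.profileRegular hB₀ hrange hσ hz
  refine ⟨fun α hα μ ν hf hst =>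
    MeanFieldMinimax.Model.isSaddle_of_isStationary hZs hWs hM hp hφ hψ hα hf hst, ?_⟩
  intro fs gs μd νd hs hμ hν hfs hgs
  have := hμ.1
  have := hν.1
  have hst : ∀ α : ℝ, 1 ≤ α → M.IsStationary b σ α
      (MeanFieldMinimax.mixture α μd) (MeanFieldMinimax.mixture α νd) := by
    intro α hα
    have := MeanFieldMinimax.isProbabilityMeasure_mixture hα μd
    have := MeanFieldMinimax.isProbabilityMeasure_mixture hα νd
    refine MeanFieldMinimax.Model.isStationary_of_isSaddle hM hp hφ hψ (fun θ => ?_) ?_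
    · rw [← MeanFieldMinimax.net_dirac]
      exact hF _ (MeanFieldMinimax.isP2_dirac θ)
    · rwa [MeanFieldMinimax.net_mixture hφ hb hα, MeanFieldMinimax.net_mixture hψ hb hα,
        ← hfs, ← hgs]
  refine ⟨fun α hα => ?_, fun hχμ hχν => ?_⟩
  · obtain ⟨D₁, hD₁, h1⟩ := MeanFieldMinimax.exists_W2_mixture_le hμ
    obtain ⟨D₂, hD₂, h2⟩ := MeanFieldMinimax.exists_W2_mixture_le hν
    have hα0 : 0 < α := zero_lt_one.trans_le hα
    -- Here the constant may depend on `α`, so the factor `α` simply absorbs the missing rate.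
    refine ⟨MeanFieldMinimax.mixture α μd, MeanFieldMinimax.mixture α νd, α * (D₁ + D₂),
      by positivity, hst α hα, ?_, ?_⟩
    · rw [inv_mul_cancel_left₀ hα0.ne']
      exact (h1 α hα).trans (ENNReal.ofReal_le_ofReal (by linarith))
    · rw [inv_mul_cancel_left₀ hα0.ne']
      exact (h2 α hα).trans (ENNReal.ofReal_le_ofReal (by linarith))
  · obtain ⟨D₁, hD₁, h1⟩ := MeanFieldMinimax.exists_W2_mixture_le_of_chiSq hμ hχμ
    obtain ⟨D₂, hD₂, h2⟩ := MeanFieldMinimax.exists_W2_mixture_le_of_chiSq hν hχν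
    refine ⟨D₁ + D₂, by positivity, fun α hα => ?_⟩
    have hα0 : 0 < α := zero_lt_one.trans_le hα
    refine ⟨MeanFieldMinimax.mixture α μd, MeanFieldMinimax.mixture α νd, hst α hα, ?_, ?_⟩
    · refine (h1 α hα).trans (ENNReal.ofReal_le_ofReal ?_)
      gcongr
      linarith
    · refine (h2 α hα).trans (ENNReal.ofReal_le_ofReal ?_)
      gcongr
      linarith
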